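/- **Setting.** Let $E_0$ be a complex Banach space, let $E\subset E_0$ and $E_n\subset E_0$, $n\in\mathbb N$, be closed subspaces, and let $P:E_0\to E$, $P_n:E_0\to E_n$ be bounded projections onto these subspaces such that $P_nx\to Px$ in $E_0$ for every $x\in E_0$. Let $T$ be a closed linear operator in $E$ and $T_n$ a closed linear operator in $E_n$, $n\in\mathbb N$ (not necessarily densely defined). For a closed operator $S$, $\rho(S)$ denotes its resolvent set and $\sigma(S)=\mathbb C\setminus\rho(S)$ its spectrum. The algebraic eigenspace of $S$ at $\lambda\in\mathbb C$ is $\bigcup_{k\in\mathbb N}\ker (S-\lambda)^k$, and its dimension is the algebraic multiplicity of $\lambda$. *Definitions.* - $T_n\to T$ in generalized strong resolvent (gsr) sense if there are $n_0\in\mathbb N$ and $\lambda\in\bigcap_{n\ge n_0}\rho(T_n)\cap\rho(T)$ such that $(T_n-\lambda)^{-1}P_nx\to(T-\lambda)^{-1}Px$ in $E_0$ for every $x\in E_0$. - The region of boundedness $\Delta_b((T_n)_{n\in\mathbb N})$ is the set of all $\lambda\in\mathbb C$ for which there is $n_0\in\mathbb N$ such that $\lambda\in\rho(T_n)$ for all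 $n\ge n_0$ and $(\|(T_n-\lambda)^{-1}\|)_{n\ge n_0}$ is bounded. - Bounded operators $A_n$ on $E_n$, $n\in\mathbb N$, form a discretely compact sequence if for every infinite $I\subset\mathbb N$ and every bounded sequence of elements $x_n\in E_n$, $n\in I$, there are $x\in E$ and an infinite $\widetilde I\subset I$ with $\|A_nx_n-x\|_{E_0}\to0$ as $n\to\infty$, $n\in\widetilde I$. **Theorem 2.6.** Assume that there is $\lambda_0\in\bigcap_{n\in\mathbb N}\rho(T_n)\cap\rho(T)$ such that $(T-\lambda_0)^{-1}$ and $(T_n-\lambda_0)^{-1}$, $n\in\mathbb N$, are compact and the sequence $((T_n-\lambda_0)^{-1})_{n\in\mathbb N}$ is discretely compact. If $T_n\to T$ in gsr sense, then the following hold. 1. $\Delta_b((T_n)_{n\in\mathbb N})=\rho(T)$, and for every $\lambda\in\rho(T)$ and every $x\in E_0$, $$(T_n-\lambda)^{-1}P_nx\to(T-\lambda)^{-1}Px\quad\text{in }E_0,\qquad n\to\infty.$$ 2. $(T_n)_{n\in\mathbb N}$ is a spectrally exact approximation of $T$, i.e. - (spectral inclusion) for every $\lambda\in\sigma(T)$ there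 are $\lambda_n\in\sigma(T_n)$, for all sufficiently large $n$, with $\lambda_n\to\lambda$; - (no spectral pollution) if $I\subset\mathbb N$ is infinite and $\lambda_n\in\sigma(T_n)$, $n\in I$, satisfy $\lambda_n\to\lambda\in\mathbb C$ as $n\to\infty$, $n\in I$, then $\lambda\in\sigma(T)$. Moreover, every eigenvalue $\lambda$ of $T$ has finite algebraic multiplicity $m$, and there are a neighbourhood $U$ of $\lambda$ and numbers $\mu_n^{(1)},\dots,\mu_n^{(m)}\in\mathbb C$, $n\in\mathbb N$, such that - $\mu_n^{(j)}\to\lambda$ as $n\to\infty$ for $j=1,\dots,m$; - for all sufficiently large $n$, $\mu_n^{(1)},\dots,\mu_n^{(m)}$ are exactly the eigenvalues of $T_n$ in $U$, repeated according to their algebraic multiplicities; - the normalized elements of the algebraic eigenspaces converge: let $L$ be the algebraic eigenspace of $T$ at $\lambda$ and $L_n$ the sum of the algebraic eigenspaces of $T_n$ at $\mu_n^{(1)},\dots,\mu_n^{(m)}$. For every $x\in L$ with $\|x\|=1$ there are, for all sufficiently large $n$, elements $x_n\in L_n$ with $\|x_n\|=1$ such that $\|x_n-x\|_{E_0}\to0$;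 and for every infinite $I\subset\mathbb N$ and all $x_n\in L_n$ with $\|x_n\|=1$, $n\in I$, there are an infinite $\widetilde I\subset I$ and $x\in L$ with $\|x\|=1$ such that $\|x_n-x\|_{E_0}\to0$ as $n\to\infty$, $n\in\widetilde I$. -/

import Mathlib

open Filter Topology

namespace GSR

section Operators

variable {F : Type*} [NormedAddCommGroup F] [NormedSpace ℂ F]

/-- The bounded operator `R` is the two-sided inverse `(T - z)⁻¹` of `T - z : dom T → F`. -/
def IsResolventAt (T : F →ₗ.[ℂ] F) (z : ℂ) (R : F →L[ℂ] F) : Prop :=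
  (∀ y : F, ∃ h : R y ∈ T.domain, T ⟨R y, h⟩ - z • R y = y) ∧
    ∀ x : T.domain, R (T x - z • (x : F)) = x

theorem IsResolventAt.unique {T : F →ₗ.[ℂ] F} {z : ℂ} {R S : F →L[ℂ] F}
    (hR : IsResolventAt T z R) (hS : IsResolventAt T z S) : R = S := by
  ext y
  obtain ⟨h, hy⟩ := hS.1 y
  have := hR.2 ⟨S y, h⟩
  simpa [hy] using this

/-- The resolvent set `ρ(T)`: those `z` for which `T - z` is a bijection from `dom T` onto `F`
with bounded inverse. -/
def resolventSet (T : F →ₗ.[ℂ] F) : Set ℂ :=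
  {z | ∃ R : F →L[ℂ] F, IsResolventAt T z R}

/-- The spectrum `σ(T)`. -/
def spectrum (T : F →ₗ.[ℂ] F) : Set ℂ := (resolventSet T)ᶜ

open scoped Classical in
/-- The resolvent `(T - z)⁻¹` for `z ∈ ρ(T)` (and the value `0` for `z ∉ ρ(T)`). -/
noncomputable def resolvent (T : F →ₗ.[ℂ] F) (z : ℂ) : F →L[ℂ] F :=
  if h : ∃ R : F →L[ℂ] F, IsResolventAt T z R then h.choose else 0

theorem isResolventAt_resolvent {T : F →ₗ.[ℂ] F} {z : ℂ} (h : z ∈ resolventSet T) :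
    IsResolventAt T z (resolvent T z) := by
  have h' : ∃ R : F →L[ℂ] F, IsResolventAt T z R := h
  rw [resolvent, dif_pos h']
  exact h'.choose_spec

/-- `z` is an eigenvalue of `T`. -/
def IsEigenvalue (T : F →ₗ.[ℂ] F) (z : ℂ) : Prop :=
  ∃ x : T.domain, (x : F) ≠ 0 ∧ T x = z • (x : F)

/-- The kernel of `(T - z) ^ k` on its natural domain: `x ∈ ker (T - z) ^ (k + 1)` iff
`x ∈ dom T` and `(T - z) x ∈ ker (T - z) ^ k`. -/
def kerPow (T : F →ₗ.[ℂ] F) (z : ℂ) : ℕ → Submodule ℂ F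
  | 0 => ⊥
  | k + 1 => ((kerPow T z k).comap (T.toFun - z • T.domain.subtype)).map T.domain.subtype

/-- The algebraic eigenspace `⋃ₖ ker (T - z) ^ k` (an increasing union). -/
def algEigenspace (T : F →ₗ.[ℂ] F) (z : ℂ) : Submodule ℂ F := ⨆ k, kerPow T z k

/-- The algebraic multiplicity of `z`, an element of `ℕ ∪ {∞}`; it is `0` if `z` is not an
eigenvalue. -/
noncomputable def algMult (T : F →ₗ.[ℂ] F) (z : ℂ) : ℕ∞ :=
  Cardinal.toENat (Module.rank ℂ (algEigenspace T z))

end Operators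

section Sequences

variable {E₀ : Type*} [NormedAddCommGroup E₀] [NormedSpace ℂ E₀]

/-- `P` is a bounded projection of `E₀` onto the subspace `E`. -/
def IsProjectionOnto (E : Submodule ℂ E₀) (P : E₀ →L[ℂ] E) : Prop :=
  ∀ x : E, P (x : E₀) = x

/-- `A_n P_n → A P` strongly, all operators being viewed as maps into `E₀`. -/
def StrongConv {E : Submodule ℂ E₀} {En : ℕ → Submodule ℂ E₀}
    (P : E₀ →L[ℂ] E) (Pn : ∀ n, E₀ →L[ℂ] En n)
    (A : E →L[ℂ] E) (An : ∀ n, En n →L[ℂ] En n) : Prop :=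
  ∀ x : E₀, Tendsto (fun n => (An n (Pn n x) : E₀)) atTop (𝓝 (A (P x) : E₀))

/-- Convergence of `(T_n)` to `T` in generalized strong resolvent sense. -/
def GSRConv {E : Submodule ℂ E₀} {En : ℕ → Submodule ℂ E₀}
    (P : E₀ →L[ℂ] E) (Pn : ∀ n, E₀ →L[ℂ] En n)
    (T : E →ₗ.[ℂ] E) (Tn : ∀ n, En n →ₗ.[ℂ] En n) : Prop :=
  ∃ (n₀ : ℕ) (z : ℂ), (∀ n ≥ n₀, z ∈ resolventSet (Tn n)) ∧ z ∈ resolventSet T ∧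
    StrongConv P Pn (resolvent T z) (fun n => resolvent (Tn n) z)

/-- The region of boundedness `Δ_b((T_n))`. -/
def regionOfBoundedness {En : ℕ → Submodule ℂ E₀} (Tn : ∀ n, En n →ₗ.[ℂ] En n) : Set ℂ :=
  {z | ∃ n₀ : ℕ, (∀ n ≥ n₀, z ∈ resolventSet (Tn n)) ∧
    ∃ M : ℝ, ∀ n ≥ n₀, ‖resolvent (Tn n) z‖ ≤ M}

/-- Discrete compactness of a sequence of bounded operators `A_n : D_n → E_n`, relative to the
limit space `E`: for every infinite `I ⊆ ℕ` and bounded `x_n ∈ D_n`, `n ∈ I`, some subsequence of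
`(A_n x_n)` converges in `E₀` to an element of `E`. -/
def DiscretelyCompact {D : ℕ → Type*} [∀ n, NormedAddCommGroup (D n)]
    [∀ n, NormedSpace ℂ (D n)] (E : Submodule ℂ E₀) {En : ℕ → Submodule ℂ E₀}
    (A : ∀ n, D n →L[ℂ] En n) : Prop :=
  ∀ I : Set ℕ, I.Infinite → ∀ x : ∀ n, D n, (∃ M : ℝ, ∀ n ∈ I, ‖x n‖ ≤ M) →
    ∃ y : E, ∃ J ⊆ I, J.Infinite ∧
      Tendsto (fun n => (A n (x n) : E₀)) (atTop ⊓ 𝓟 J) (𝓝 (y : E₀))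

/-- Every point of `σ(T)` is the limit of points `u_n ∈ σ(T_n)` (`n` sufficiently large). -/
def SpectrallyInclusive {E : Submodule ℂ E₀} {En : ℕ → Submodule ℂ E₀}
    (T : E →ₗ.[ℂ] E) (Tn : ∀ n, En n →ₗ.[ℂ] En n) : Prop :=
  ∀ z ∈ spectrum T, ∃ u : ℕ → ℂ, (∀ᶠ n in atTop, u n ∈ spectrum (Tn n)) ∧
    Tendsto u atTop (𝓝 z)

/-- `z` is a spurious eigenvalue: `z ∉ σ(T)`, but `z` is the limit of points `u_n ∈ σ(T_n)` along
an infinite set of indices. -/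
def IsSpurious {E : Submodule ℂ E₀} {En : ℕ → Submodule ℂ E₀}
    (T : E →ₗ.[ℂ] E) (Tn : ∀ n, En n →ₗ.[ℂ] En n) (z : ℂ) : Prop :=
  z ∉ spectrum T ∧ ∃ I : Set ℕ, I.Infinite ∧ ∃ u : ℕ → ℂ, (∀ n ∈ I, u n ∈ spectrum (Tn n)) ∧
    Tendsto u (atTop ⊓ 𝓟 I) (𝓝 z)

/-- Spectral exactness: spectral inclusion and no spectral pollution. -/
def SpectrallyExact {E : Submodule ℂ E₀} {En : ℕ → Submodule ℂ E₀}
    (T : E →ₗ.[ℂ] E) (Tn : ∀ n, En n →ₗ.[ℂ] En n) : Prop :=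
  SpectrallyInclusive T Tn ∧ ∀ z : ℂ, ¬ IsSpurious T Tn z

/-- The sum of the algebraic eigenspaces of `S` at the points `v j`. -/
def sumAlgEigenspaces {F : Type*} [NormedAddCommGroup F] [NormedSpace ℂ F] {m : ℕ}
    (S : F →ₗ.[ℂ] F) (v : Fin m → ℂ) : Submodule ℂ F :=
  ⨆ j, algEigenspace S (v j)

/-- Convergence of the normalized elements of subspaces `L_n ⊆ E_n` to those of `L ⊆ E` with
respect to the norm of `E₀`: every unit vector of `L` is the limit of unit vectors of the `L_n`,
and every sequence of unit vectors of the `L_n` (along an infinite index set) has a subsequence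
which converges to a unit vector of `L`. -/
def UnitVectorsConverge {E : Submodule ℂ E₀} {En : ℕ → Submodule ℂ E₀}
    (L : Submodule ℂ E) (Ln : ∀ n, Submodule ℂ (En n)) : Prop :=
  (∀ x ∈ L, ‖x‖ = 1 → ∃ y : ∀ n, En n, (∀ᶠ n in atTop, y n ∈ Ln n ∧ ‖y n‖ = 1) ∧
    Tendsto (fun n => (y n : E₀)) atTop (𝓝 (x : E₀))) ∧
  ∀ I : Set ℕ, I.Infinite → ∀ y : ∀ n, En n, (∀ n ∈ I, y n ∈ Ln n ∧ ‖y n‖ = 1) →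
    ∃ x ∈ L, ‖x‖ = 1 ∧ ∃ J ⊆ I, J.Infinite ∧
      Tendsto (fun n => (y n : E₀)) (atTop ⊓ 𝓟 J) (𝓝 (x : E₀))

end Sequences

end GSR

/-! Everything is transferred to resolvents at the point `l` supplied by gsr convergence. Put `A =
(T - l)⁻¹` and `A_n = (T_n - l)⁻¹`. The resolvent identity moves compactness and discrete
compactness from `z₀` to `l`, so the compact operators `A_n` converge discretely to the compact
operator `A` (`DiscreteConv`). The map `w ↦ (w - l)⁻¹` carries eigenvalues and root spaces of `T` to
those of `A`, and the Fredholm alternative turns the rest of the spectrum into eigenvalues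
(`IsResolventAt.mem_spectrum_iff`, `IsResolventAt.algEigenspace_eq`).

The analytic core is a uniform lower bound for `A_n - μ` on compact sets of `μ ≠ 0` free of
eigenvalues of `A` (`DiscreteConv.exists_lower_bound`): otherwise normalized approximate
eigenvectors would have a limit that is an eigenvector of `A`. This gives bounded resolvents and
their strong convergence; the absence of pollution comes from the same passage to the limit in
eigenvectors.

For multiplicities, let `V_n` be the sum of the root spaces of `A_n` in a small disc about an
eigenvalue `μ₀ ≠ 0` of `A`, and `L` the root space of `A` at `μ₀`. No Riesz projections are used.
Upper bound: `V_n` is the end of a flag of unit vectors, each an eigenvector modulo its predecessors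
and at distance at least `1 / 2` from their span. By induction on the length, bounded sequences in
such flags converge along ultrafilters to elements of `L`. A flag longer than `dim L` would contain
unit vectors killed by a projection onto `L`, which is impossible in the limit. Lower bound: on the
quotient by `V_n` the operator induced by `A_n` has no eigenvalue in the disc, so the maximum
principle carries the bound on the circle to the centre. Hence vectors nearly annihilated by `(A_n -
μ₀) ^ k` are close to `V_n`, and every element of `L` is a limit of elements of the `V_n`. Together
these give equality of dimensions and convergence of unit vectors; spectral inclusion follows, since
the multiplicity is positive.

Limits are taken along ultrafilters, which replaces repeated extraction of subsequences. -/

namespace GSR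

/-! ### Linear algebra of sums of root spaces -/

section Algebra

variable {F : Type*} [AddCommGroup F] [Module ℂ F]

/-- The sum of the algebraic eigenspaces of `A` at the points of `K`. -/
def genSup (A : Module.End ℂ F) (K : Set ℂ) : Submodule ℂ F :=
  ⨆ μ : K, A.maxGenEigenspace μ

theorem maxGenEigenspace_le_genSup (A : Module.End ℂ F) {K : Set ℂ} {μ : ℂ} (hμ : μ ∈ K) :
    A.maxGenEigenspace μ ≤ genSup A K :=
  le_iSup (fun μ : K => A.maxGenEigenspace μ) ⟨μ, hμ⟩

theorem mem_maxGenEigenspace_of_sub_mem {A : Module.End ℂ F} {μ : ℂ} {x : F}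
    (h : A x - μ • x ∈ A.maxGenEigenspace μ) : x ∈ A.maxGenEigenspace μ := by
  rw [Module.End.mem_maxGenEigenspace] at h ⊢
  obtain ⟨k, hk⟩ := h
  refine ⟨k + 1, ?_⟩
  rw [pow_succ, Module.End.mul_apply]
  simpa using hk

theorem map_mem_maxGenEigenspace {A : Module.End ℂ F} {μ : ℂ} {x : F}
    (h : x ∈ A.maxGenEigenspace μ) : A x ∈ A.maxGenEigenspace μ :=
  Module.End.mapsTo_maxGenEigenspace_of_comm (Commute.refl A) μ h

theorem map_mem_genSup {A : Module.End ℂ F} {K : Set ℂ} {x : F}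
    (h : x ∈ genSup A K) : A x ∈ genSup A K := by
  have : genSup A K ≤ (genSup A K).comap A :=
    iSup_le fun μ y hy => maxGenEigenspace_le_genSup A μ.2 (map_mem_maxGenEigenspace hy)
  exact this h

/-- On the root space at `ν` one has `A - μ = (ν - μ) + (A - ν)`, a nonzero scalar plus a locally
nilpotent map, hence a surjection. The induction inverts it one nilpotency step at a time. -/
theorem exists_sub_smul_eq_of_mem_genEigenspace {A : Module.End ℂ F} {μ ν : ℂ} (hne : μ ≠ ν)
    (k : ℕ) : ∀ y : F, ((A - ν • 1) ^ k) y = 0 →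
      ∃ x ∈ A.maxGenEigenspace ν, A x - μ • x = y := by
  induction k with
  | zero => intro y hy; exact ⟨0, zero_mem _, by simpa using hy.symm⟩
  | succ k ih =>
    intro y hy
    have h1 : ((A - ν • 1) ^ k) (A y - ν • y) = 0 := by
      rw [pow_succ, Module.End.mul_apply] at hy
      simpa using hy
    obtain ⟨x, hx, hxy⟩ := ih _ h1
    have hy' : y ∈ A.maxGenEigenspace ν := (Module.End.mem_maxGenEigenspace _ _ _).2 ⟨_, hy⟩
    refine ⟨(ν - μ)⁻¹ • (y - x), Submodule.smul_mem _ _ (sub_mem hy' hx), ?_⟩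
    have h0 : ν - μ ≠ 0 := sub_ne_zero.2 hne.symm
    rw [map_smul, smul_comm μ, ← smul_sub, inv_smul_eq_iff₀ h0, map_sub, smul_sub]
    have : A y - A x - (μ • y - μ • x) = (A y - μ • y) - (A x - μ • x) := by abel
    rw [this, hxy, sub_smul]
    abel

/-- This makes `A - μ` injective on the quotient by `genSup A K`. Modulo the root space at `μ`, the
map `A - μ` is onto `genSup A K`, so `x` differs from an element of `genSup A K` by a root vector at
`μ`. -/
theorem mem_genSup_of_sub_mem {A : Module.End ℂ F} {K : Set ℂ} {μ : ℂ} (hμ : μ ∈ K) {x : F}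
    (h : A x - μ • x ∈ genSup A K) : x ∈ genSup A K := by
  have key : ∀ y ∈ genSup A K, ∃ x ∈ genSup A K, A x - μ • x - y ∈ A.maxGenEigenspace μ := by
    intro y hy
    induction hy using Submodule.iSup_induction' with
    | mem ν y hy =>
      by_cases hne : μ = ν
      · exact ⟨0, zero_mem _, by simpa [hne] using hy⟩
      · obtain ⟨k, hk⟩ := (Module.End.mem_maxGenEigenspace _ _ _).1 hy
        obtain ⟨x, hx, hxy⟩ := exists_sub_smul_eq_of_mem_genEigenspace hne k y hk
        exact ⟨x, maxGenEigenspace_le_genSup A ν.2 hx, by simp [hxy]⟩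
    | zero => exact ⟨0, zero_mem _, by simp⟩
    | add y z hy hz ihy ihz =>
      obtain ⟨a, ha, ha'⟩ := ihy
      obtain ⟨b, hb, hb'⟩ := ihz
      refine ⟨a + b, add_mem ha hb, ?_⟩
      have : A (a + b) - μ • (a + b) - (y + z) =
          (A a - μ • a - y) + (A b - μ • b - z) := by
        rw [map_add, smul_add]; abel
      rw [this]
      exact add_mem ha' hb'
  obtain ⟨y, hy, hyx⟩ := key _ h
  have h1 : y - x ∈ A.maxGenEigenspace μ := by
    apply mem_maxGenEigenspace_of_sub_mem
    convert hyx using 1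
    rw [map_sub, smul_sub]; abel
  have := sub_mem hy (maxGenEigenspace_le_genSup A hμ h1)
  simpa using this

/-- A submodule strictly smaller than `genSup A K` can be enlarged by a vector which is a
generalized eigenvector modulo the submodule. -/
theorem exists_mem_genSup_notMem {A : Module.End ℂ F} {K : Set ℂ} {N : Submodule ℂ F}
    (h : ¬ genSup A K ≤ N) :
    ∃ x ∈ genSup A K, x ∉ N ∧ ∃ μ ∈ K, A x - μ • x ∈ N := by
  classical
  have h1 : ∃ μ : K, ¬ A.maxGenEigenspace μ ≤ N := by
    by_contra! h'
    exact h (iSup_le h')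
  obtain ⟨μ, hμ⟩ := h1
  obtain ⟨y, hy, hyN⟩ := Set.not_subset.1 hμ
  obtain ⟨k, hk⟩ := (Module.End.mem_maxGenEigenspace _ _ _).1 hy
  -- Take the least power of `A - μ` that kills some vector outside `N`. Then `A x - μ • x`, killed
  -- by one power fewer, has to lie in `N`.
  have hex : ∃ k, ∃ x, ((A - (μ : ℂ) • (1 : Module.End ℂ F)) ^ k) x = 0 ∧ x ∉ N := ⟨k, y, hk, hyN⟩
  obtain ⟨x, hx, hxN⟩ := Nat.find_spec hex
  refine ⟨x, maxGenEigenspace_le_genSup A μ.2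
    ((Module.End.mem_maxGenEigenspace _ _ _).2 ⟨_, hx⟩), hxN, μ, μ.2, ?_⟩
  by_contra hN
  rcases hj : Nat.find hex with _ | j
  · rw [hj] at hx
    simp only [pow_zero, Module.End.one_apply] at hx
    exact hxN (hx ▸ zero_mem _)
  · refine Nat.find_min hex (m := j) (by omega) ⟨_, ?_, hN⟩
    rw [hj, pow_succ, Module.End.mul_apply] at hx
    simpa using hx

theorem maxGenEigenspace_eq_bot_iff {A : Module.End ℂ F} {μ : ℂ} :
    A.maxGenEigenspace μ = ⊥ ↔ ¬ A.HasEigenvalue μ := by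
  have := Module.End.hasUnifEigenvalue_iff_hasUnifEigenvalue_one (f := A) (μ := μ) (k := ⊤) (by simp)
  exact not_iff_not.1 (by rw [not_not]; exact this)

theorem genSup_inter_eigenvalues (A : Module.End ℂ F) (K : Set ℂ) :
    genSup A (K ∩ {μ | A.HasEigenvalue μ}) = genSup A K := by
  apply le_antisymm
  · exact iSup_le fun μ => maxGenEigenspace_le_genSup A μ.2.1
  · refine iSup_le fun μ => ?_
    by_cases h : A.HasEigenvalue μ
    · exact maxGenEigenspace_le_genSup A ⟨μ.2, h⟩
    · rw [maxGenEigenspace_eq_bot_iff.2 h]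
      exact bot_le

/-- The eigenvalues of `A` in `K` can be listed according to their algebraic multiplicities. -/
theorem exists_enumeration (A : Module.End ℂ F) (K : Set ℂ)
    [FiniteDimensional ℂ (genSup A K)] {m : ℕ} (hm : Module.finrank ℂ (genSup A K) = m) :
    ∃ v : Fin m → ℂ, (∀ j, v j ∈ K ∧ A.HasEigenvalue (v j)) ∧
      (∀ w ∈ K, Module.finrank ℂ (A.maxGenEigenspace w) = Nat.card {j // v j = w}) ∧
      ⨆ j, A.maxGenEigenspace (v j) = genSup A K := by
  classical
  have hfd : ∀ w : K, FiniteDimensional ℂ (A.maxGenEigenspace w) := fun w =>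
    Submodule.finiteDimensional_of_le (maxGenEigenspace_le_genSup A w.2)
  have hind : iSupIndep fun w : K => A.maxGenEigenspace w :=
    (Module.End.independent_maxGenEigenspace A).comp Subtype.val_injective
  let φ := DFinsupp.lsum ℕ (fun w : K => (A.maxGenEigenspace (w : ℂ)).subtype)
  have hinj : Function.Injective φ := hind.dfinsupp_lsum_injective
  have hrange : LinearMap.range φ = genSup A K :=
    (Submodule.iSup_eq_range_dfinsupp_lsum _).symm
  let e : (Π₀ w : K, A.maxGenEigenspace (w : ℂ)) ≃ₗ[ℂ] genSup A K :=
    (LinearEquiv.ofInjective φ hinj).trans (LinearEquiv.ofEq _ _ hrange)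
  let b := (DFinsupp.basis fun w : K => Module.finBasis ℂ (A.maxGenEigenspace (w : ℂ))).map e
  have : Fintype (Σ w : K, Fin (Module.finrank ℂ (A.maxGenEigenspace (w : ℂ)))) :=
    @Fintype.ofFinite _ (Module.Finite.finite_basis b)
  have hcard : Fintype.card (Σ w : K, Fin (Module.finrank ℂ (A.maxGenEigenspace (w : ℂ)))) = m := by
    rw [← hm, Module.finrank_eq_card_basis b]
  -- The list has one entry per vector of a basis adapted to the direct sum of root spaces, namely
  -- the point to which that vector belongs. Each point is thereby repeated according to its
  -- multiplicity.
  let q := (Fintype.equivFinOfCardEq hcard).symm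
  have hev : ∀ j, A.HasEigenvalue ((q j).1 : ℂ) := by
    intro j
    by_contra h
    have h0 := maxGenEigenspace_eq_bot_iff.2 h
    have h1 : Module.finrank ℂ (A.maxGenEigenspace ((q j).1 : ℂ)) = 0 := by
      rw [h0]; exact finrank_bot ℂ F
    exact (Fin.cast h1 (q j).2).elim0
  have hcnt : ∀ w ∈ K, Module.finrank ℂ (A.maxGenEigenspace w) =
      Nat.card {j // ((q j).1 : ℂ) = w} := by
    intro w hw
    have e1 : {j // ((q j).1 : ℂ) = w} ≃
        {p : Σ w : K, Fin (Module.finrank ℂ (A.maxGenEigenspace (w : ℂ))) // p.1 = ⟨w, hw⟩} :=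
      q.subtypeEquiv fun j => by simp [Subtype.ext_iff]
    rw [Nat.card_congr (e1.trans (Equiv.sigmaSubtype _))]
    simp
  have hmem : ∀ w ∈ K, A.HasEigenvalue w → ∃ j, ((q j).1 : ℂ) = w := by
    intro w hw hw'
    by_contra! h
    have : IsEmpty {j // ((q j).1 : ℂ) = w} := ⟨fun j => h j.1 j.2⟩
    have h1 := hcnt w hw
    rw [Nat.card_of_isEmpty] at h1
    have := hfd ⟨w, hw⟩
    exact (not_not.2 hw') (maxGenEigenspace_eq_bot_iff.1 (Submodule.finrank_eq_zero.1 h1))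
  refine ⟨fun j => (q j).1, fun j => ⟨(q j).1.2, hev j⟩, hcnt, le_antisymm ?_ ?_⟩
  · exact iSup_le fun j => maxGenEigenspace_le_genSup A (q j).1.2
  · rw [← genSup_inter_eigenvalues]
    refine iSup_le fun w => ?_
    obtain ⟨j, hj⟩ := hmem w w.2.1 w.2.2
    rw [← hj]
    exact le_iSup (fun j => A.maxGenEigenspace ((q j).1 : ℂ)) j

end Algebra

/-! ### Riesz theory of a compact operator via flags -/

section Flags

variable {F : Type*} [NormedAddCommGroup F] [NormedSpace ℂ F]

/-- Riesz's lemma is applied inside `N ⊔ ℂ ∙ x`, so that the new vector is a combination of `x` and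
`N` and remains an eigenvector modulo `N` whenever `x` is one and `N` is invariant. -/
theorem exists_norm_eq_one_riesz {N V : Submodule ℂ F} [FiniteDimensional ℂ N] {x : F}
    (hx : x ∈ V) (hxN : x ∉ N) (hNV : N ≤ V) :
    ∃ e ∈ V, e ∉ N ∧ ‖e‖ = 1 ∧ (∀ y ∈ N, 1 / 2 ≤ ‖e - y‖) ∧
      ∃ c : ℂ, ∃ y ∈ N, e = c • x + y := by
  let W : Submodule ℂ F := N ⊔ ℂ ∙ x
  have hNW : N ≤ W := le_sup_left
  have hxW : x ∈ W := (le_sup_right : _ ≤ W) (Submodule.mem_span_singleton_self x)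
  have hcl : IsClosed ((N.comap W.subtype : Submodule ℂ W) : Set W) :=
    N.closed_of_finiteDimensional.preimage continuous_subtype_val
  obtain ⟨e, heN, he, hd⟩ := riesz_lemma_of_lt_one hcl ⟨⟨x, hxW⟩, hxN⟩
    (show (1 / 2 : ℝ) < 1 by norm_num)
  have hWV : W ≤ V := sup_le hNV ((Submodule.span_singleton_le_iff_mem _ _).2 hx)
  refine ⟨e, hWV e.2, heN, he, fun y hy => hd ⟨y, hNW hy⟩ hy, ?_⟩
  obtain ⟨y, hy, z, hz, h⟩ := Submodule.mem_sup.1 e.2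
  obtain ⟨c, rfl⟩ := Submodule.mem_span_singleton.1 hz
  exact ⟨c, y, hy, by rw [← h, add_comm]⟩

/-- `M` is the last member of a flag of length `d` of subspaces, each of which is obtained from
the previous one `N` by adjoining a unit vector at distance at least `1 / 2` from `N` which is
modulo `N` an eigenvector of `A` with eigenvalue in `K`. -/
inductive IsFlag (A : F →L[ℂ] F) (K : Set ℂ) : ℕ → Submodule ℂ F → Prop
  | bot : IsFlag A K 0 ⊥
  | step {d : ℕ} {N : Submodule ℂ F} {x : F} {μ : ℂ} (hN : IsFlag A K d N) (hμ : μ ∈ K)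
      (hx : ‖x‖ = 1) (hd : ∀ y ∈ N, 1 / 2 ≤ ‖x - y‖) (hA : A x - μ • x ∈ N) :
      IsFlag A K (d + 1) (N ⊔ ℂ ∙ x)

theorem IsFlag.finiteDimensional {A : F →L[ℂ] F} {K : Set ℂ} {d : ℕ} {M : Submodule ℂ F}
    (h : IsFlag A K d M) : FiniteDimensional ℂ M := by
  induction h with
  | bot => infer_instance
  | step hN hμ hx hd hA ih => infer_instance

theorem IsFlag.finrank {A : F →L[ℂ] F} {K : Set ℂ} {d : ℕ} {M : Submodule ℂ F}
    (h : IsFlag A K d M) : Module.finrank ℂ M = d := by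
  induction h with
  | bot => exact finrank_bot ℂ F
  | @step d N x μ hN hμ hx hd hA ih =>
    have := hN.finiteDimensional
    have hxN : x ∉ N := fun h => by
      have := hd x h
      norm_num at this
    have hx0 : x ≠ 0 := fun h => hxN (h ▸ zero_mem _)
    have h1 := Submodule.finrank_sup_add_finrank_inf_eq N (ℂ ∙ x)
    have h2 : N ⊓ (ℂ ∙ x) = ⊥ := by
      rw [← disjoint_iff, Submodule.disjoint_span_singleton' hx0]
      exact hxN
    rw [h2, finrank_bot, ih, finrank_span_singleton hx0] at h1
    simpa using h1

theorem IsFlag.map_mem {A : F →L[ℂ] F} {K : Set ℂ} {d : ℕ} {M : Submodule ℂ F}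
    (h : IsFlag A K d M) : ∀ x ∈ M, A x ∈ M := by
  induction h with
  | bot => intro x hx; simp_all
  | @step d N x μ hN hμ hx hd hA ih =>
    intro y hy
    obtain ⟨n, hn, z, hz, rfl⟩ := Submodule.mem_sup.1 hy
    obtain ⟨c, rfl⟩ := Submodule.mem_span_singleton.1 hz
    have hx' : x ∈ N ⊔ ℂ ∙ x :=
      (le_sup_right : _ ≤ N ⊔ ℂ ∙ x) (Submodule.mem_span_singleton_self x)
    have h1 : A x ∈ N ⊔ ℂ ∙ x := by
      have := add_mem ((le_sup_left : _ ≤ N ⊔ ℂ ∙ x) hA) (Submodule.smul_mem _ μ hx')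
      simpa using this
    rw [map_add, map_smul]
    exact add_mem ((le_sup_left : _ ≤ N ⊔ ℂ ∙ x) (ih n hn)) (Submodule.smul_mem _ c h1)

theorem IsFlag.exists_le {A : F →L[ℂ] F} {K : Set ℂ} {d : ℕ} {M : Submodule ℂ F}
    (h : IsFlag A K d M) : ∀ e ≤ d, ∃ N ≤ M, IsFlag A K e N := by
  induction h with
  | bot => intro e he; exact ⟨⊥, le_rfl, Nat.le_zero.1 he ▸ .bot⟩
  | step hN hμ hx hd hA ih =>
    intro e he
    rcases Nat.lt_or_eq_of_le he with h | rfl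
    · obtain ⟨N', h1, h2⟩ := ih e (by omega)
      exact ⟨N', h1.trans le_sup_left, h2⟩
    · exact ⟨_, le_rfl, .step hN hμ hx hd hA⟩

/-- A proper finite-dimensional invariant subspace of `genSup A K` can be enlarged by a unit
vector far from it. -/
theorem exists_step {A : F →L[ℂ] F} {K : Set ℂ} {N : Submodule ℂ F} [FiniteDimensional ℂ N]
    (hinv : ∀ x ∈ N, A x ∈ N) (hN : N ≤ genSup (A : Module.End ℂ F) K)
    (hne : ¬ genSup (A : Module.End ℂ F) K ≤ N) :
    ∃ x ∈ genSup (A : Module.End ℂ F) K, ‖x‖ = 1 ∧ (∀ y ∈ N, 1 / 2 ≤ ‖x - y‖) ∧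
      ∃ μ ∈ K, A x - μ • x ∈ N := by
  obtain ⟨x, hx, hxN, μ, hμ, hAx⟩ := exists_mem_genSup_notMem hne
  obtain ⟨e, he, -, he1, hd, c, y, hy, rfl⟩ := exists_norm_eq_one_riesz hx hxN hN
  refine ⟨_, he, he1, hd, μ, hμ, ?_⟩
  have : A (c • x + y) - μ • (c • x + y) = c • (A x - μ • x) + (A y - μ • y) := by
    rw [map_add, map_smul, smul_add, smul_sub, smul_comm μ c]; abel
  rw [this]
  exact add_mem (Submodule.smul_mem _ _ hAx) (sub_mem (hinv y hy) (Submodule.smul_mem _ _ hy))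

theorem isFlag_genSup (A : F →L[ℂ] F) (K : Set ℂ)
    [FiniteDimensional ℂ (genSup (A : Module.End ℂ F) K)] :
    IsFlag A K (Module.finrank ℂ (genSup (A : Module.End ℂ F) K))
      (genSup (A : Module.End ℂ F) K) := by
  have key : ∀ d ≤ Module.finrank ℂ (genSup (A : Module.End ℂ F) K),
      ∃ M ≤ genSup (A : Module.End ℂ F) K, IsFlag A K d M := by
    intro d
    induction d with
    | zero => intro _; exact ⟨⊥, bot_le, .bot⟩
    | succ d ih =>
      intro hd
      obtain ⟨N, hN, hf⟩ := ih (by omega)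
      have := hf.finiteDimensional
      have hne : ¬ genSup (A : Module.End ℂ F) K ≤ N := fun h => by
        have := Submodule.finrank_mono h
        rw [hf.finrank] at this
        omega
      obtain ⟨x, hx, hx1, hd, μ, hμ, hA⟩ := exists_step hf.map_mem hN hne
      exact ⟨_, sup_le hN ((Submodule.span_singleton_le_iff_mem _ _).2 hx),
        .step hf hμ hx1 hd hA⟩
  obtain ⟨M, hM, hf⟩ := key _ le_rfl
  have := Submodule.eq_of_le_of_finrank_eq hM hf.finrank
  rwa [this] at hf

/-- The classical argument of Riesz: an infinite-dimensional sum would allow an endless flag, and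
the images under `A` of its unit vectors would be `c / 2`-separated, against compactness. -/
theorem finiteDimensional_genSup {A : F →L[ℂ] F} (hA : IsCompactOperator A) {K : Set ℂ} {c : ℝ}
    (hc : 0 < c) (hK : ∀ μ ∈ K, c ≤ ‖μ‖) :
    FiniteDimensional ℂ (genSup (A : Module.End ℂ F) K) := by
  set V := genSup (A : Module.End ℂ F) K
  by_contra hinf
  let S := {N : Submodule ℂ F // FiniteDimensional ℂ N ∧ (∀ x ∈ N, A x ∈ N) ∧ N ≤ V}
  have hstep : ∀ N : S, ∃ x ∈ V, ‖x‖ = 1 ∧ (∀ y ∈ N.1, 1 / 2 ≤ ‖x - y‖) ∧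
      ∃ μ ∈ K, A x - μ • x ∈ N.1 := by
    rintro ⟨N, hfd, hinv, hNV⟩
    refine exists_step hinv hNV fun h => hinf ?_
    exact Submodule.finiteDimensional_of_le h
  choose e heV he1 hed μ hμK heμ using hstep
  let next : S → S := fun N => ⟨N.1 ⊔ ℂ ∙ e N, by
    have := N.2.1
    infer_instance, by
    intro y hy
    obtain ⟨n, hn, z, hz, rfl⟩ := Submodule.mem_sup.1 hy
    obtain ⟨c, rfl⟩ := Submodule.mem_span_singleton.1 hz
    have hx' : e N ∈ N.1 ⊔ ℂ ∙ e N :=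
      (le_sup_right : _ ≤ N.1 ⊔ ℂ ∙ e N) (Submodule.mem_span_singleton_self _)
    have h1 : A (e N) ∈ N.1 ⊔ ℂ ∙ e N := by
      have := add_mem ((le_sup_left : _ ≤ N.1 ⊔ ℂ ∙ e N) (heμ N)) (Submodule.smul_mem _ (μ N) hx')
      simpa using this
    rw [map_add, map_smul]
    exact add_mem ((le_sup_left : _ ≤ N.1 ⊔ ℂ ∙ e N) (N.2.2.1 n hn)) (Submodule.smul_mem _ c h1),
    sup_le N.2.2.2 ((Submodule.span_singleton_le_iff_mem _ _).2 (heV N))⟩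
  let M : ℕ → S := fun n => next^[n] ⟨⊥, inferInstance, by simp, bot_le⟩
  have hMs : ∀ n, M (n + 1) = next (M n) := fun n => Function.iterate_succ_apply' next n _
  have hmono : Monotone fun n => (M n).1 := monotone_nat_of_le_succ fun n => by
    rw [hMs]; exact le_sup_left
  have hemem : ∀ n, e (M n) ∈ (M (n + 1)).1 := fun n => by
    rw [hMs]
    exact (le_sup_right : _ ≤ (M n).1 ⊔ ℂ ∙ e (M n)) (Submodule.mem_span_singleton_self _)
  -- Modulo `M n` the difference equals `μ • e (M n)` with `c ≤ ‖μ‖`, and `e (M n)` has distance at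
  -- least `1 / 2` from `M n`.
  have hsep : ∀ m n, m < n → c / 2 ≤ ‖A (e (M n)) - A (e (M m))‖ := by
    intro m n hmn
    have h1 : A (e (M m)) ∈ (M n).1 := (M n).2.2.1 _ (hmono hmn (hemem m))
    have h2 := sub_mem h1 (heμ (M n))
    have hμ0 : μ (M n) ≠ 0 := norm_pos_iff.1 (hc.trans_le (hK _ (hμK _)))
    have h3 := hed (M n) _ (Submodule.smul_mem _ (μ (M n))⁻¹ h2)
    have h4 : A (e (M n)) - A (e (M m)) = μ (M n) • (e (M n) -
        (μ (M n))⁻¹ • (A (e (M m)) - (A (e (M n)) - μ (M n) • e (M n)))) := by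
      rw [smul_sub, smul_inv_smul₀ hμ0]; abel
    rw [h4, norm_smul]
    have := hK _ (hμK (M n))
    nlinarith
  obtain ⟨C, hC, hC'⟩ := hA.image_closedBall_subset_compact (f := (A : F →ₗ[ℂ] F)) 1
  obtain ⟨y, -, ψ, hψ, hψy⟩ := hC.tendsto_subseq (x := fun n => A (e (M n)))
    (fun n => hC' ⟨e (M n), by simp [he1], rfl⟩)
  obtain ⟨N, hN⟩ := Metric.cauchySeq_iff'.1 hψy.cauchySeq (c / 2) (by positivity)
  have h1 := hN (N + 1) (by omega)
  rw [dist_eq_norm] at h1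
  exact absurd h1 (not_lt.2 (hsep _ _ (hψ (Nat.lt_succ_self N))))

theorem finite_eigenvalues {A : F →L[ℂ] F} (hA : IsCompactOperator A) {K : Set ℂ} {c : ℝ}
    (hc : 0 < c) (hK : ∀ μ ∈ K, c ≤ ‖μ‖) :
    (K ∩ {μ | Module.End.HasEigenvalue (A : Module.End ℂ F) μ}).Finite := by
  have := finiteDimensional_genSup hA hc hK
  obtain ⟨v, -, hv, -⟩ := exists_enumeration (A : Module.End ℂ F) K rfl
  refine (Set.finite_range v).subset ?_
  rintro μ ⟨hμ, hμe⟩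
  by_contra h
  have he : IsEmpty {j // v j = μ} := ⟨fun j => h ⟨j.1, j.2⟩⟩
  have h1 := hv μ hμ
  rw [Nat.card_of_isEmpty] at h1
  have := Submodule.finiteDimensional_of_le (maxGenEigenspace_le_genSup (A : Module.End ℂ F) hμ)
  exact (not_not.2 hμe) (maxGenEigenspace_eq_bot_iff.1 (Submodule.finrank_eq_zero.1 h1))

/-- The nonzero eigenvalues of a compact operator are isolated. -/
theorem exists_closedBall_eigenvalue {A : F →L[ℂ] F} (hA : IsCompactOperator A) {μ₀ : ℂ}
    (h0 : μ₀ ≠ 0) : ∃ r > 0, (∀ μ ∈ Metric.closedBall μ₀ r, ‖μ₀‖ / 2 ≤ ‖μ‖) ∧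
      ∀ μ ∈ Metric.closedBall μ₀ r, Module.End.HasEigenvalue (A : Module.End ℂ F) μ → μ = μ₀ := by
  have hpos : 0 < ‖μ₀‖ := norm_pos_iff.2 h0
  have hb : ∀ μ ∈ Metric.closedBall μ₀ (‖μ₀‖ / 2), ‖μ₀‖ / 2 ≤ ‖μ‖ := by
    intro μ hμ
    rw [Metric.mem_closedBall, dist_comm, dist_eq_norm] at hμ
    have := norm_sub_norm_le μ₀ μ
    linarith
  have hfin := (finite_eigenvalues hA (half_pos hpos) hb).subset (Set.sdiff_subset (t := {μ₀}))
  have hnhds := (hfin.isClosed.isOpen_compl).mem_nhds (show μ₀ ∈ _ by simp)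
  obtain ⟨r, hr, hr'⟩ := Metric.nhds_basis_closedBall.mem_iff.1 hnhds
  refine ⟨min r (‖μ₀‖ / 2), lt_min hr (half_pos hpos), fun μ hμ => hb μ ?_, fun μ hμ he => ?_⟩
  · exact Metric.closedBall_subset_closedBall (min_le_right _ _) hμ
  · by_contra hne
    exact hr' (Metric.closedBall_subset_closedBall (min_le_left _ _) hμ)
      ⟨⟨Metric.closedBall_subset_closedBall (min_le_right _ _) hμ, he⟩, hne⟩

/-! ### Lower bounds on quotients by the maximum principle -/

theorem resolvent_smul_sub_apply {B : F →L[ℂ] F} {μ : ℂ} (h : μ ∈ _root_.resolventSet ℂ B) (q : F) :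
    _root_.resolvent B μ (μ • q - B q) = q := by
  have := Ring.inverse_mul_cancel _ h
  have h2 := congrArg (fun f : F →L[ℂ] F => f q) this
  simpa [_root_.resolvent, Algebra.algebraMap_eq_smul_one] using h2

theorem smul_sub_resolvent_apply {B : F →L[ℂ] F} {μ : ℂ} (h : μ ∈ _root_.resolventSet ℂ B) (q : F) :
    μ • _root_.resolvent B μ q - B (_root_.resolvent B μ q) = q := by
  have := Ring.mul_inverse_cancel _ h
  have h2 := congrArg (fun f : F →L[ℂ] F => f q) this
  simpa [_root_.resolvent, Algebra.algebraMap_eq_smul_one] using h2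

/-- Let `B` be the operator induced by a compact operator `A` on a quotient. If `B` has no
eigenvalues in a disc, then `B - μ₀` at the centre `μ₀` satisfies the lower bound which `A - μ`
satisfies for `μ` on the circle (by the maximum principle). -/
theorem norm_le_of_quotient {Q : Type*} [NormedAddCommGroup Q] [NormedSpace ℂ Q] [CompleteSpace F]
    [CompleteSpace Q] {A : F →L[ℂ] F} (hA : IsCompactOperator A) {B : Q →L[ℂ] Q}
    (hBc : IsCompactOperator B) {π : F →L[ℂ] Q} (hB : ∀ x, B (π x) = π (A x))
    (hπ : ∀ x, ‖π x‖ ≤ ‖x‖) (hlift : ∀ q, ∀ ε > 0, ∃ x, π x = q ∧ ‖x‖ < ‖q‖ + ε)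
    {μ₀ : ℂ} {r C : ℝ} (hr : 0 < r) (hC : 0 ≤ C) (h0 : ∀ μ ∈ Metric.closedBall μ₀ r, μ ≠ 0)
    (hinj : ∀ μ ∈ Metric.closedBall μ₀ r, ∀ y, π (A y - μ • y) = 0 → π y = 0)
    (hb : ∀ μ ∈ Metric.sphere μ₀ r, ∀ x, ‖x‖ ≤ C * ‖A x - μ • x‖) (y : F) :
    ‖π y‖ ≤ C * ‖π (A y - μ₀ • y)‖ := by
  have hsurj' : ∀ q, ∃ x, π x = q := fun q => (hlift q 1 one_pos).imp fun x hx => hx.1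
  have hres : ∀ μ ∈ Metric.closedBall μ₀ r, μ ∈ _root_.resolventSet ℂ B := by
    intro μ hμ
    refine (hBc.hasEigenvalue_or_mem_resolventSet (h0 μ hμ)).resolve_left fun h => ?_
    obtain ⟨q, hq, hq0⟩ := h.exists_hasEigenvector
    obtain ⟨x, rfl⟩ := hsurj' q
    rw [Module.End.mem_eigenspace_iff] at hq
    refine hq0 (hinj μ hμ x ?_)
    rw [map_sub, map_smul, ← hB, sub_eq_zero]
    exact hq
  have hleft : ∀ μ ∈ Metric.closedBall μ₀ r, ∀ q,
      (_root_.resolvent B μ) (μ • q - B q) = q := fun μ hμ q =>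
    resolvent_smul_sub_apply (hres μ hμ) q
  have hbd : ∀ μ ∈ Metric.sphere μ₀ r, ‖_root_.resolvent B μ‖ ≤ C := by
    intro μ hμ
    have hμ' := Metric.sphere_subset_closedBall hμ
    have hne : ¬ Module.End.HasEigenvalue (A : Module.End ℂ F) μ := fun h => by
      obtain ⟨x, hx, hx0⟩ := h.exists_hasEigenvector
      rw [Module.End.mem_eigenspace_iff] at hx
      have h1 := hb μ hμ x
      have h2 : A x - μ • x = 0 := sub_eq_zero.2 hx
      rw [h2, norm_zero, mul_zero] at h1
      exact hx0 (norm_le_zero_iff.1 h1)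
    have hunit := (hA.hasEigenvalue_or_mem_resolventSet (h0 μ hμ')).resolve_left hne
    have hsurj : ∀ v, ∃ x, μ • x - A x = v := fun v =>
      ⟨_root_.resolvent A μ v, smul_sub_resolvent_apply hunit v⟩
    refine ContinuousLinearMap.opNorm_le_bound _ hC fun q => ?_
    refine le_of_forall_pos_le_add fun ε hε => ?_
    -- The slack `ε / (C + 1)` stays below `ε` after multiplication by `C`, also when `C = 0`.
    obtain ⟨v, rfl, hv⟩ := hlift q (ε / (C + 1)) (by positivity)
    obtain ⟨x, hx⟩ := hsurj v
    have h1 : _root_.resolvent B μ (π v) = π x := by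
      rw [← hx, map_sub, map_smul, ← hB]
      exact hleft μ hμ' _
    have h2 : ‖x‖ ≤ C * ‖v‖ := by
      have := hb μ hμ x
      rwa [norm_sub_rev (A x), hx] at this
    calc ‖_root_.resolvent B μ (π v)‖ = ‖π x‖ := by rw [h1]
      _ ≤ ‖x‖ := hπ x
      _ ≤ C * ‖v‖ := h2
      _ ≤ C * (‖π v‖ + ε / (C + 1)) := by gcongr
      _ = C * ‖π v‖ + C / (C + 1) * ε := by ring
      _ ≤ C * ‖π v‖ + 1 * ε := by
          gcongr
          rw [div_le_one (by positivity)]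
          linarith
      _ = C * ‖π v‖ + ε := by rw [one_mul]
  have hdiff : DifferentiableOn ℂ (_root_.resolvent B) (Metric.closedBall μ₀ r) := fun μ hμ =>
    (spectrum.hasDerivAt_resolvent_const_left (hres μ hμ)).differentiableAt.differentiableWithinAt
  have hmax := Complex.norm_le_of_forall_mem_frontier_norm_le (Metric.isBounded_ball (x := μ₀)
    (r := r)) (DifferentiableOn.diffContOnCl (by rwa [closure_ball μ₀ hr.ne']))
    (C := C) (by rwa [frontier_ball μ₀ hr.ne']) (z := μ₀) (subset_closure (Metric.mem_ball_self hr))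
  have h1 := hleft μ₀ (Metric.mem_closedBall_self hr.le) (π y)
  have h2 : μ₀ • π y - B (π y) = - π (A y - μ₀ • y) := by
    rw [hB, map_sub, map_smul]; abel
  rw [h2] at h1
  calc ‖π y‖ = ‖_root_.resolvent B μ₀ (-π (A y - μ₀ • y))‖ := by rw [h1]
    _ ≤ C * ‖-π (A y - μ₀ • y)‖ := ContinuousLinearMap.le_of_opNorm_le _ hmax _
    _ = _ := by rw [norm_neg]

/-- The lower bound of `norm_le_of_quotient` on the quotient by a finite-dimensional invariant
subspace `V` containing all root vectors for the points of the disc. -/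
theorem norm_mkQ_le [CompleteSpace F] {A : F →L[ℂ] F} (hA : IsCompactOperator A)
    {V : Submodule ℂ F} [FiniteDimensional ℂ V] (hinv : ∀ x ∈ V, A x ∈ V) {μ₀ : ℂ} {r C : ℝ}
    (hr : 0 < r) (hC : 0 ≤ C) (h0 : ∀ μ ∈ Metric.closedBall μ₀ r, μ ≠ 0)
    (hinj : ∀ μ ∈ Metric.closedBall μ₀ r, ∀ y, A y - μ • y ∈ V → y ∈ V)
    (hb : ∀ μ ∈ Metric.sphere μ₀ r, ∀ x, ‖x‖ ≤ C * ‖A x - μ • x‖) (y : F) :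
    ‖V.mkQ y‖ ≤ C * ‖V.mkQ (A y - μ₀ • y)‖ := by
  have hVc : IsClosed (V : Set F) := V.closed_of_finiteDimensional
  have hmk : ∀ x, V.mkQL x = 0 ↔ x ∈ V := fun x => Submodule.Quotient.mk_eq_zero V
  have hker : V ≤ (V.mkQL.comp A).ker := fun x hx => (hmk _).2 (hinv x hx)
  have hBc : IsCompactOperator (V.liftQL (V.mkQL.comp A) hker) := by
    obtain ⟨K, hK, hK'⟩ := hA.clm_comp V.mkQL
    refine ⟨K, hK, ?_⟩
    -- The induced operator is compact because the quotient map is open: it sends the neighbourhood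
    -- on which `V.mkQL ∘ A` has values in `K` to a neighbourhood of zero.
    have h1 := V.isOpenQuotientMap_mkQL.isOpenMap.image_mem_nhds hK'
    rw [map_zero] at h1
    refine Filter.mem_of_superset h1 ?_
    rintro _ ⟨x, hx, rfl⟩
    exact hx
  exact norm_le_of_quotient (π := V.mkQL) hA hBc (fun x => rfl)
    (fun x => Submodule.Quotient.norm_mk_le V x)
    (fun q ε hε => Submodule.Quotient.norm_mk_lt (S := V) q hε) hr hC h0
    (fun μ hμ y hy => (hmk y).2 (hinj μ hμ y ((hmk _).1 hy))) hb y

/-- The power is needed because elements of a root space are annihilated only by some `(A - μ₀) ^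
k`. The bound says that vectors almost annihilated by it are close to `V`. -/
theorem norm_mkQ_le_pow [CompleteSpace F] {A : F →L[ℂ] F} (hA : IsCompactOperator A)
    {V : Submodule ℂ F} [FiniteDimensional ℂ V] (hinv : ∀ x ∈ V, A x ∈ V) {μ₀ : ℂ} {r C : ℝ}
    (hr : 0 < r) (hC : 0 ≤ C) (h0 : ∀ μ ∈ Metric.closedBall μ₀ r, μ ≠ 0)
    (hinj : ∀ μ ∈ Metric.closedBall μ₀ r, ∀ y, A y - μ • y ∈ V → y ∈ V)
    (hb : ∀ μ ∈ Metric.sphere μ₀ r, ∀ x, ‖x‖ ≤ C * ‖A x - μ • x‖) (k : ℕ) (y : F) :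
    ‖V.mkQ y‖ ≤ C ^ k * ‖((A - μ₀ • 1 : F →L[ℂ] F) ^ k) y‖ := by
  have h : ‖V.mkQ y‖ ≤ C ^ k * ‖V.mkQ (((A - μ₀ • 1 : F →L[ℂ] F) ^ k) y)‖ := by
    induction k with
    | zero => simp
    | succ k ih =>
      refine ih.trans ?_
      rw [pow_succ C, mul_assoc]
      gcongr
      rw [pow_succ' (A - μ₀ • 1 : F →L[ℂ] F)]
      exact norm_mkQ_le hA hinv hr hC h0 hinj hb _
  refine h.trans ?_
  gcongr
  exact Submodule.Quotient.norm_mk_le V _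

end Flags

/-! ### Discrete convergence of compact operators -/

section Discrete

variable {E₀ : Type*} [NormedAddCommGroup E₀] [NormedSpace ℂ E₀]

theorem exists_ultrafilter_of_not_eventually {α : Type*} {l : Filter α} {p : α → Prop}
    (h : ¬ ∀ᶠ n in l, p n) : ∃ U : Ultrafilter α, ↑U ≤ l ∧ ∀ᶠ n in U, ¬ p n := by
  have h1 := mt mem_iff_ultrafilter.2 h
  push Not at h1
  obtain ⟨U, hU, hp⟩ := h1
  exact ⟨U, hU, Ultrafilter.eventually_not.2 hp⟩

/-- Discrete convergence of compact operators `A_n` on `E_n` to a compact operator `A` on `E`,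
with the compactness expressed by ultrafilters. -/
structure DiscreteConv (E : Submodule ℂ E₀) (En : ℕ → Submodule ℂ E₀) (A : E →L[ℂ] E)
    (An : ∀ n, En n →L[ℂ] En n) : Prop where
  compact : IsCompactOperator A
  compact_seq : ∀ n, IsCompactOperator (An n)
  approx : ∀ x : E, ∃ y : ∀ n, En n, Tendsto (fun n => (y n : E₀)) atTop (𝓝 (x : E₀))
  tendsto : ∀ l ≤ atTop, ∀ (x : ∀ n, En n) (y : E), Tendsto (fun n => (x n : E₀)) l (𝓝 (y : E₀)) →
    Tendsto (fun n => (An n (x n) : E₀)) l (𝓝 (A y : E₀))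
  exists_lim : ∀ U : Ultrafilter ℕ, ↑U ≤ (atTop : Filter ℕ) → ∀ (x : ∀ n, En n) (M : ℝ),
    (∀ᶠ n in U, ‖x n‖ ≤ M) → ∃ y : E, Tendsto (fun n => (An n (x n) : E₀)) U (𝓝 (y : E₀))

variable {E : Submodule ℂ E₀} {En : ℕ → Submodule ℂ E₀} {A : E →L[ℂ] E}
  {An : ∀ n, En n →L[ℂ] En n}

/-- Solve for `x n` as `(u n)⁻¹` times the difference of `An n (x n)` and the residual. Both terms
converge, the first by discrete compactness, and `u n` stays away from zero because `μ ≠ 0`. -/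
theorem DiscreteConv.exists_tendsto (h : DiscreteConv E En A An) {U : Ultrafilter ℕ}
    (hU : ↑U ≤ (atTop : Filter ℕ)) {μ : ℂ} (hμ : μ ≠ 0) {u : ℕ → ℂ} (hu : Tendsto u U (𝓝 μ))
    {x : ∀ n, En n} {M : ℝ} (hx : ∀ᶠ n in U, ‖x n‖ ≤ M) {w : E}
    (hw : Tendsto (fun n => ((An n (x n) - u n • x n : En n) : E₀)) U (𝓝 (w : E₀))) :
    ∃ z : E, Tendsto (fun n => (x n : E₀)) U (𝓝 (z : E₀)) ∧ A z - μ • z = w := by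
  obtain ⟨y, hy⟩ := h.exists_lim U hU x M hx
  have hxz : Tendsto (fun n => (x n : E₀)) U (𝓝 ((μ⁻¹ • (y - w) : E) : E₀)) := by
    have h1 := (hu.inv₀ hμ).smul (hy.sub hw)
    refine (h1.congr' ?_)
    filter_upwards [hu.eventually_ne hμ] with n hn
    have : (An n (x n) : E₀) - ((An n (x n) - u n • x n : En n) : E₀) = u n • (x n : E₀) := by
      simp
    rw [this, inv_smul_smul₀ hn]
  refine ⟨_, hxz, ?_⟩
  have h2 : A (μ⁻¹ • (y - w)) = y :=
    Subtype.ext (tendsto_nhds_unique (h.tendsto U hU x _ hxz) hy)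
  rw [h2, smul_inv_smul₀ hμ]
  abel

theorem DiscreteConv.hasEigenvalue (h : DiscreteConv E En A An) {U : Ultrafilter ℕ}
    (hU : ↑U ≤ (atTop : Filter ℕ)) {μ : ℂ} (hμ : μ ≠ 0) {u : ℕ → ℂ} (hu : Tendsto u U (𝓝 μ))
    {x : ∀ n, En n} (hx : ∀ᶠ n in U, ‖x n‖ = 1)
    (hw : Tendsto (fun n => ((An n (x n) - u n • x n : En n) : E₀)) U (𝓝 0)) :
    Module.End.HasEigenvalue (A : Module.End ℂ E) μ := by
  obtain ⟨z, hz, hAz⟩ := h.exists_tendsto hU hμ hu (hx.mono fun n hn => hn.le) (w := 0)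
    (by simpa using hw)
  have hz1 : ‖(z : E₀)‖ = 1 := tendsto_nhds_unique hz.norm
    (tendsto_const_nhds.congr' (hx.mono fun n hn => hn.symm))
  refine Module.End.hasEigenvalue_of_hasEigenvector (x := z) ⟨?_, ?_⟩
  · rw [Module.End.mem_eigenspace_iff]
    exact sub_eq_zero.1 hAz
  · rintro rfl
    simp at hz1

/-- Limits of eigenvalues of the `A_n` are eigenvalues of `A`. -/
theorem DiscreteConv.hasEigenvalue_of_tendsto (h : DiscreteConv E En A An) {U : Ultrafilter ℕ}
    (hU : ↑U ≤ (atTop : Filter ℕ)) {μ : ℂ} (hμ : μ ≠ 0) {u : ℕ → ℂ} (hu : Tendsto u U (𝓝 μ))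
    (he : ∀ᶠ n in U, Module.End.HasEigenvalue (An n : Module.End ℂ (En n)) (u n)) :
    Module.End.HasEigenvalue (A : Module.End ℂ E) μ := by
  have : ∀ n, ∃ x : En n, Module.End.HasEigenvalue (An n : Module.End ℂ (En n)) (u n) →
      ‖x‖ = 1 ∧ An n x - u n • x = 0 := by
    intro n
    by_cases hn : Module.End.HasEigenvalue (An n : Module.End ℂ (En n)) (u n)
    · obtain ⟨x, hx, hx0⟩ := hn.exists_hasEigenvector
      refine ⟨((‖x‖⁻¹ : ℝ) : ℂ) • x, fun _ => ⟨?_, ?_⟩⟩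
      · rw [Complex.ofReal_inv]; exact norm_smul_inv_norm hx0
      · rw [Module.End.mem_eigenspace_iff] at hx
        have hx' : An n x = u n • x := hx
        rw [map_smul, hx', smul_comm, sub_self]
    · exact ⟨0, fun h => absurd h hn⟩
  choose x hx using this
  refine h.hasEigenvalue hU hμ hu (x := x) (he.mono fun n hn => (hx n hn).1) ?_
  exact tendsto_const_nhds.congr' (he.mono fun n hn => by simp [(hx n hn).2])

/-- On a compact set without eigenvalues of `A`, the operators `A_n - μ` are uniformly bounded
from below. -/
theorem DiscreteConv.exists_lower_bound (h : DiscreteConv E En A An) {K : Set ℂ}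
    (hK : IsCompact K) (h0 : ∀ μ ∈ K, μ ≠ 0)
    (he : ∀ μ ∈ K, ¬ Module.End.HasEigenvalue (A : Module.End ℂ E) μ) :
    ∃ C : ℝ, 0 ≤ C ∧ ∀ᶠ n in atTop, ∀ μ ∈ K, ∀ x : En n, ‖x‖ ≤ C * ‖An n x - μ • x‖ := by
  by_contra! hcon
  have hfreq : ∀ k : ℕ, ∃ᶠ n in atTop, ∃ μ ∈ K, ∃ x : En n,
      ‖x‖ = 1 ∧ ‖An n x - μ • x‖ < 1 / ((k : ℝ) + 1) := by
    -- Failure of the bound with constant `k + 1` yields, after normalization, approximate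
    -- eigenvectors with error below `1 / (k + 1)`.
    intro k
    refine (hcon (k + 1) (by positivity)).mono ?_
    rintro n ⟨μ, hμ, x, hx⟩
    have hx0 : x ≠ 0 := by
      rintro rfl
      simp at hx
    have hpos := norm_pos_iff.2 hx0
    refine ⟨μ, hμ, ((‖x‖⁻¹ : ℝ) : ℂ) • x, ?_, ?_⟩
    · rw [Complex.ofReal_inv]; exact norm_smul_inv_norm hx0
    · have : An n (((‖x‖⁻¹ : ℝ) : ℂ) • x) - μ • ((‖x‖⁻¹ : ℝ) : ℂ) • x =
          ((‖x‖⁻¹ : ℝ) : ℂ) • (An n x - μ • x) := by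
        rw [map_smul, smul_sub, smul_comm μ]
      rw [this, norm_smul, Complex.norm_real, norm_inv, norm_norm, inv_mul_lt_iff₀ hpos,
        mul_one_div, lt_div_iff₀ (by positivity), mul_comm]
      exact hx
  obtain ⟨ψ, hψ, hψk⟩ := extraction_forall_of_frequently hfreq
  -- The vectors exist only at the indices `ψ k`; elsewhere zero is inserted. The ultrafilter chosen
  -- below contains the range of `ψ`, so these values do not matter.
  have : ∀ n, ∃ p : En n × ℂ, ∀ k, ψ k = n →
      ‖p.1‖ = 1 ∧ p.2 ∈ K ∧ ‖An n p.1 - p.2 • p.1‖ < 1 / ((k : ℝ) + 1) := by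
    intro n
    by_cases hn : ∃ k, ψ k = n
    · obtain ⟨k, rfl⟩ := hn
      obtain ⟨μ, hμ, x, hx1, hx2⟩ := hψk k
      refine ⟨(x, μ), fun j hj => ?_⟩
      obtain rfl := hψ.injective hj
      exact ⟨hx1, hμ, hx2⟩
    · exact ⟨(0, 0), fun k hk => absurd ⟨k, hk⟩ hn⟩
  choose p hp using this
  obtain ⟨U, hU⟩ := Ultrafilter.exists_le (map ψ atTop)
  have hUt : (U : Filter ℕ) ≤ atTop := hU.trans hψ.tendsto_atTop
  have hev : ∀ᶠ n in (U : Filter ℕ), ‖(p n).1‖ = 1 ∧ (p n).2 ∈ K :=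
    hU (eventually_map.2 (Eventually.of_forall fun k => ⟨(hp _ k rfl).1, (hp _ k rfl).2.1⟩))
  have hlim : Tendsto (fun n => ((An n (p n).1 - (p n).2 • (p n).1 : En n) : E₀)) U (𝓝 0) := by
    refine Tendsto.mono_left ?_ hU
    rw [tendsto_map'_iff]
    refine squeeze_zero_norm (fun k => ?_) tendsto_one_div_add_atTop_nhds_zero_nat
    exact (hp (ψ k) k rfl).2.2.le
  obtain ⟨μ, hμ, hle⟩ := hK.ultrafilter_le_nhds (U.map fun n => (p n).2)
    (le_principal_iff.2 (hev.mono fun n hn => hn.2))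
  exact he μ hμ (h.hasEigenvalue hUt (h0 μ hμ) (u := fun n => (p n).2) hle
    (hev.mono fun n hn => hn.1) hlim)

/-- Bounded sequences in the final spaces of flags of a fixed length, with eigenvalues tending to
`μ₀`, converge along ultrafilters to elements of the algebraic eigenspace of `A` at `μ₀`. -/
theorem DiscreteConv.exists_tendsto_of_isFlag (h : DiscreteConv E En A An) {U : Ultrafilter ℕ}
    (hU : ↑U ≤ (atTop : Filter ℕ)) {μ₀ : ℂ} (hμ₀ : μ₀ ≠ 0) {K : ℕ → Set ℂ}
    (hK : ∀ ε > 0, ∀ᶠ n in U, K n ⊆ Metric.ball μ₀ ε) (d : ℕ) :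
    ∀ M : ∀ n, Submodule ℂ (En n), (∀ᶠ n in U, IsFlag (An n) (K n) d (M n)) →
      ∀ (y : ∀ n, En n) (R : ℝ), (∀ᶠ n in U, y n ∈ M n ∧ ‖y n‖ ≤ R) →
        ∃ x ∈ Module.End.maxGenEigenspace (A : Module.End ℂ E) μ₀,
          Tendsto (fun n => (y n : E₀)) U (𝓝 (x : E₀)) := by
  induction d with
  | zero =>
    intro M hM y R hy
    refine ⟨0, zero_mem _, tendsto_const_nhds.congr' ?_⟩
    filter_upwards [hM, hy] with n hn hyn
    have h1 := hyn.1
    generalize M n = N at hn h1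
    rcases hn with _ | _
    have := (Submodule.mem_bot ℂ).1 h1
    simp [this]
  | succ d ih =>
    intro M hM y R hy
    have : ∀ n, ∃ (N : Submodule ℂ (En n)) (x : En n) (μ : ℂ), IsFlag (An n) (K n) (d + 1) (M n) →
        IsFlag (An n) (K n) d N ∧ μ ∈ K n ∧ ‖x‖ = 1 ∧ (∀ y ∈ N, 1 / 2 ≤ ‖x - y‖) ∧
          An n x - μ • x ∈ N ∧ M n = N ⊔ ℂ ∙ x := by
      intro n
      by_cases hn : IsFlag (An n) (K n) (d + 1) (M n)
      · generalize hMn : M n = M' at hn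
        rcases hn with _ | @⟨_, N, x, μ, hN, hμ, hx, hd, hA⟩
        exact ⟨N, x, μ, fun _ => ⟨hN, hμ, hx, hd, hA, rfl⟩⟩
      · exact ⟨⊥, 0, 0, fun h => absurd h hn⟩
    choose N x μ hNx using this
    have hev := hM.mono fun n hn => hNx n hn
    have hNf := hev.mono fun n hn => hn.1
    have hμ : Tendsto μ U (𝓝 μ₀) := by
      rw [Metric.tendsto_nhds]
      intro ε hε
      filter_upwards [hK ε hε, hev] with n h1 h2
      exact h1 h2.2.1
    -- The limit `a` serves only to bound `An n (x n)`, since `DiscreteConv` provides no uniform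
    -- norm bound for the `An n`.
    obtain ⟨a, ha⟩ := h.exists_lim U hU x 1 (hev.mono fun n hn => hn.2.2.1.le)
    have hbd : ∀ᶠ n in U, ‖An n (x n) - μ n • x n‖ ≤ (‖(a : E₀)‖ + 1) + (‖μ₀‖ + 1) := by
      filter_upwards [hev, ha.norm.eventually_lt_const (lt_add_one _),
        hμ.norm.eventually_lt_const (lt_add_one _)] with n h1 h2 h3
      refine (norm_sub_le _ _).trans (add_le_add h2.le ?_)
      rw [norm_smul, h1.2.2.1, mul_one]
      exact h3.le
    obtain ⟨w, hw, hwt⟩ := ih N hNf (fun n => An n (x n) - μ n • x n) _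
      (hev.and hbd |>.mono fun n hn => ⟨hn.1.2.2.2.2.1, hn.2⟩)
    obtain ⟨z, hz, hAz⟩ := h.exists_tendsto hU hμ₀ hμ (hev.mono fun n hn => hn.2.2.1.le) hwt
    have hzL : z ∈ Module.End.maxGenEigenspace (A : Module.End ℂ E) μ₀ := by
      apply mem_maxGenEigenspace_of_sub_mem
      change A z - μ₀ • z ∈ _
      rw [hAz]
      exact hw
    have : ∀ n, ∃ c : ℂ, y n ∈ M n → IsFlag (An n) (K n) (d + 1) (M n) → y n - c • x n ∈ N n := by
      intro n
      by_cases hn : y n ∈ M n ∧ IsFlag (An n) (K n) (d + 1) (M n)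
      · have h1 := hn.1
        rw [(hNx n hn.2).2.2.2.2.2] at h1
        obtain ⟨v, hv, s, hs, hvs⟩ := Submodule.mem_sup.1 h1
        obtain ⟨c, rfl⟩ := Submodule.mem_span_singleton.1 hs
        exact ⟨c, fun _ _ => by rwa [← hvs, add_sub_cancel_right]⟩
      · exact ⟨0, fun h1 h2 => absurd ⟨h1, h2⟩ hn⟩
    choose c hc using this
    have hcN : ∀ᶠ n in U, y n - c n • x n ∈ N n := by
      filter_upwards [hM, hy] with n h1 h2 using hc n h2.1 h1
    -- Since `x n` has distance at least `1 / 2` from `N n`, so does `(c n)⁻¹ • y n`, which differs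
    -- from `x n` by an element of `N n`. Thus the coefficients are bounded and `c n` converges
    -- along `U`.
    have hcb : ∀ᶠ n in U, ‖c n‖ ≤ 2 * R := by
      filter_upwards [hev, hy, hcN] with n h1 h2 h3
      by_cases hc0 : c n = 0
      · rw [hc0, norm_zero]
        have := (norm_nonneg _).trans h2.2
        linarith
      · have h4 := h1.2.2.2.1 _ (Submodule.smul_mem _ (-(c n)⁻¹) h3)
        have h5 : x n - -(c n)⁻¹ • (y n - c n • x n) = (c n)⁻¹ • y n := by
          rw [neg_smul, smul_sub, inv_smul_smul₀ hc0]; abel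
        rw [h5, norm_smul, norm_inv, ← div_eq_inv_mul, le_div_iff₀ (norm_pos_iff.2 hc0)] at h4
        linarith [h2.2]
    obtain ⟨c₀, -, hc₀⟩ := (isCompact_closedBall (0 : ℂ) (2 * R)).ultrafilter_le_nhds (U.map c)
      (le_principal_iff.2 (hcb.mono fun n hn => by simpa using hn))
    obtain ⟨v, hv, hvt⟩ := ih N hNf (fun n => y n - c n • x n) (R + 2 * R) (by
      filter_upwards [hcN, hcb, hy, hev] with n h1 h2 h3 h4
      refine ⟨h1, (norm_sub_le _ _).trans (add_le_add h3.2 ?_)⟩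
      rw [norm_smul, h4.2.2.1, mul_one]
      exact h2)
    refine ⟨v + c₀ • z, add_mem hv (Submodule.smul_mem _ _ hzL), ?_⟩
    have h1 := hvt.add (Tendsto.smul (f := c) hc₀ hz)
    simpa using h1

end Discrete

/-! ### Convergence of spectral subspaces and their dimensions -/

section DiscreteSpectrum

variable {E₀ : Type*} [NormedAddCommGroup E₀] [NormedSpace ℂ E₀] {E : Submodule ℂ E₀}
  {En : ℕ → Submodule ℂ E₀} {A : E →L[ℂ] E} {An : ∀ n, En n →L[ℂ] En n}

theorem finiteDimensional_maxGenEigenspace {F : Type*} [NormedAddCommGroup F] [NormedSpace ℂ F]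
    {A : F →L[ℂ] F} (hA : IsCompactOperator A) {μ : ℂ} (hμ : μ ≠ 0) :
    FiniteDimensional ℂ (Module.End.maxGenEigenspace (A : Module.End ℂ F) μ) := by
  have := finiteDimensional_genSup hA (norm_pos_iff.2 hμ) (K := {μ}) (by simp)
  exact Submodule.finiteDimensional_of_le
    (maxGenEigenspace_le_genSup (A : Module.End ℂ F) (Set.mem_singleton μ))

/-- What is left of `K` outside the ball is compact and free of eigenvalues of `A`, so the uniform
lower bound excludes eigenvalues of `An n` there. -/
theorem DiscreteConv.eventually_eigenvalues_subset (h : DiscreteConv E En A An) {K : Set ℂ}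
    (hK : IsCompact K) (h0 : ∀ μ ∈ K, μ ≠ 0) {μ₀ : ℂ}
    (he : ∀ μ ∈ K, Module.End.HasEigenvalue (A : Module.End ℂ E) μ → μ = μ₀) {ε : ℝ} (hε : 0 < ε) :
    ∀ᶠ n in atTop, K ∩ {μ | Module.End.HasEigenvalue (An n : Module.End ℂ (En n)) μ} ⊆
      Metric.ball μ₀ ε := by
  have hK' : IsCompact (K \ Metric.ball μ₀ ε) := hK.diff Metric.isOpen_ball
  obtain ⟨C, -, hC⟩ := h.exists_lower_bound hK' (fun μ hμ => h0 μ hμ.1) (fun μ hμ hev => by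
    rw [he μ hμ.1 hev] at hμ
    exact hμ.2 (Metric.mem_ball_self hε))
  filter_upwards [hC] with n hn
  rintro μ ⟨hμ, hev⟩
  by_contra hb
  obtain ⟨x, hx, hx0⟩ := hev.exists_hasEigenvector
  rw [Module.End.mem_eigenspace_iff] at hx
  have h1 := hn μ ⟨hμ, hb⟩ x
  have h2 : An n x - μ • x = 0 := sub_eq_zero.2 hx
  rw [h2, norm_zero, mul_zero] at h1
  exact hx0 (norm_le_zero_iff.1 h1)

/-- If `d` exceeded `dim L`, a continuous projection `f` onto `L` would have a kernel vector of norm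
one in each `M n`. Its limit along `U` lies in `L` and is killed by `f`, hence is zero, yet has norm
one. -/
theorem DiscreteConv.le_finrank_of_isFlag (h : DiscreteConv E En A An) {U : Ultrafilter ℕ}
    (hU : ↑U ≤ (atTop : Filter ℕ)) {μ₀ : ℂ} (hμ₀ : μ₀ ≠ 0) {K : ℕ → Set ℂ}
    (hK : ∀ ε > 0, ∀ᶠ n in U, K n ⊆ Metric.ball μ₀ ε) {d : ℕ} {M : ∀ n, Submodule ℂ (En n)}
    (hM : ∀ᶠ n in U, IsFlag (An n) (K n) d (M n)) :
    d ≤ Module.finrank ℂ (Module.End.maxGenEigenspace (A : Module.End ℂ E) μ₀) := by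
  by_contra! hlt
  have hfd := finiteDimensional_maxGenEigenspace h.compact hμ₀
  set L := Module.End.maxGenEigenspace (A : Module.End ℂ E) μ₀
  let L₀ : Submodule ℂ E₀ := L.map E.subtype
  have hL₀ : Module.finrank ℂ L₀ = Module.finrank ℂ L :=
    (Submodule.equivMapOfInjective E.subtype E.subtype_injective L).finrank_eq.symm
  obtain ⟨f, hf⟩ := Submodule.ClosedComplemented.of_finiteDimensional L₀
  have : ∀ n, ∃ x : En n, IsFlag (An n) (K n) d (M n) → x ∈ M n ∧ ‖x‖ = 1 ∧ f (x : E₀) = 0 := by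
    intro n
    by_cases hn : IsFlag (An n) (K n) d (M n)
    · have := hn.finiteDimensional
      let g : M n →ₗ[ℂ] L₀ := (f : E₀ →ₗ[ℂ] L₀) ∘ₗ (En n).subtype ∘ₗ (M n).subtype
      have hker : LinearMap.ker g ≠ ⊥ := LinearMap.ker_ne_bot_of_finrank_lt (by
        rw [hn.finrank, hL₀]; exact hlt)
      obtain ⟨x, hx, hx0⟩ := Submodule.exists_mem_ne_zero_of_ne_bot hker
      have hx0' : (x : En n) ≠ 0 := fun h => hx0 (Subtype.ext h)
      refine ⟨((‖(x : En n)‖⁻¹ : ℝ) : ℂ) • (x : En n), fun _ => ⟨?_, ?_, ?_⟩⟩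
      · exact Submodule.smul_mem _ _ x.2
      · rw [Complex.ofReal_inv]; exact norm_smul_inv_norm hx0'
      · have hfx : f ((x : En n) : E₀) = 0 := hx
        rw [Submodule.coe_smul, map_smul, hfx, smul_zero]
    · exact ⟨0, fun h => absurd h hn⟩
  choose x hx using this
  have hev := hM.mono fun n hn => hx n hn
  obtain ⟨z, hz, hzt⟩ := h.exists_tendsto_of_isFlag hU hμ₀ hK d M hM x 1
    (hev.mono fun n hn => ⟨hn.1, hn.2.1.le⟩)
  have h1 : f (z : E₀) = 0 := tendsto_nhds_unique ((f.continuous.tendsto _).comp hzt)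
    (tendsto_const_nhds.congr' (hev.mono fun n hn => hn.2.2.symm))
  have h2 := hf ⟨(z : E₀), z, hz, rfl⟩
  have h3 : (z : E₀) = 0 := by
    have := congrArg (Subtype.val) (h2.symm.trans h1)
    exact this
  have h4 : ‖(z : E₀)‖ = 1 := tendsto_nhds_unique hzt.norm
    (tendsto_const_nhds.congr' (hev.mono fun n hn => hn.2.1.symm))
  rw [h3, norm_zero] at h4
  exact zero_ne_one h4

theorem coe_sub_smul_one_pow_apply {F : Type*} [NormedAddCommGroup F] [NormedSpace ℂ F]
    (A : F →L[ℂ] F) (μ : ℂ) (k : ℕ) (x : F) :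
    ((A - μ • 1 : F →L[ℂ] F) ^ k) x = (((A : Module.End ℂ F) - μ • 1) ^ k) x := by
  induction k generalizing x with
  | zero => rfl
  | succ k ih =>
    rw [pow_succ, pow_succ]
    exact ih _

/-- Every element of the algebraic eigenspace of `A` at `μ₀` is a limit of elements of the sums of
the algebraic eigenspaces of the `A_n` in a disc around `μ₀`. -/
theorem DiscreteConv.exists_approx_mem_genSup [CompleteSpace E₀] (h : DiscreteConv E En A An)
    (hEn : ∀ n, IsClosed (En n : Set E₀)) {μ₀ : ℂ} {r : ℝ} (hr : 0 < r)
    (h0 : ∀ μ ∈ Metric.closedBall μ₀ r, μ ≠ 0)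
    (he : ∀ μ ∈ Metric.closedBall μ₀ r,
      Module.End.HasEigenvalue (A : Module.End ℂ E) μ → μ = μ₀)
    (hfd : ∀ n, FiniteDimensional ℂ
      (genSup (An n : Module.End ℂ (En n)) (Metric.closedBall μ₀ r)))
    {x : E} (hx : x ∈ Module.End.maxGenEigenspace (A : Module.End ℂ E) μ₀) :
    ∃ v : ∀ n, En n, (∀ n, v n ∈ genSup (An n : Module.End ℂ (En n)) (Metric.closedBall μ₀ r)) ∧
      Tendsto (fun n => (v n : E₀)) atTop (𝓝 (x : E₀)) := by
  obtain ⟨C, hC, hbd⟩ := h.exists_lower_bound (isCompact_sphere μ₀ r)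
    (fun μ hμ => h0 μ (Metric.sphere_subset_closedBall hμ)) (fun μ hμ hev => by
      rw [he μ (Metric.sphere_subset_closedBall hμ) hev, Metric.mem_sphere, dist_self] at hμ
      exact hr.ne hμ)
  obtain ⟨k, hk⟩ := (Module.End.mem_maxGenEigenspace _ _ _).1 hx
  rw [← coe_sub_smul_one_pow_apply] at hk
  obtain ⟨y, hy⟩ := h.approx x
  have hpow : ∀ j : ℕ, Tendsto (fun n => ((((An n - μ₀ • 1 : En n →L[ℂ] En n) ^ j) (y n) : En n) :
      E₀)) atTop (𝓝 (((A - μ₀ • 1 : E →L[ℂ] E) ^ j) x : E₀)) := by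
    intro j
    induction j with
    | zero => simpa using hy
    | succ j ih =>
      have h1 := (h.tendsto _ le_rfl _ _ ih).sub (ih.const_smul μ₀)
      simp only [pow_succ', mul_apply_eq_comp]
      simpa using h1
  have hk0 := (hpow k).norm
  rw [hk, Submodule.coe_zero, norm_zero] at hk0
  have hcl : ∀ n, CompleteSpace (En n) := fun n => (hEn n).completeSpace_coe
  -- The quotient norm is an infimum, so a representative `w` is chosen almost optimally, with a
  -- vanishing error `1 / (n + 1)`.
  have : ∀ n, ∃ w : En n, y n - w ∈ genSup (An n : Module.End ℂ (En n)) (Metric.closedBall μ₀ r) ∧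
      ‖w‖ ≤ ‖(genSup (An n : Module.End ℂ (En n)) (Metric.closedBall μ₀ r)).mkQ (y n)‖ +
        1 / ((n : ℝ) + 1) := by
    intro n
    obtain ⟨w, hw, hw'⟩ := Submodule.Quotient.norm_mk_lt
      (S := genSup (An n : Module.End ℂ (En n)) (Metric.closedBall μ₀ r))
      (Submodule.Quotient.mk (y n)) (show 0 < 1 / ((n : ℝ) + 1) by positivity)
    exact ⟨w, (Submodule.Quotient.eq _).1 hw.symm, hw'.le⟩
  choose w hwV hw using this
  refine ⟨fun n => y n - w n, hwV, ?_⟩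
  have hw0 : Tendsto (fun n => (w n : E₀)) atTop (𝓝 0) := by
    refine squeeze_zero_norm' (a := fun n => C ^ k *
      ‖((((An n - μ₀ • 1 : En n →L[ℂ] En n) ^ k) (y n) : En n) : E₀)‖ + 1 / ((n : ℝ) + 1)) ?_ ?_
    · filter_upwards [hbd] with n hn
      refine (hw n).trans (add_le_add_left ?_ _)
      exact norm_mkQ_le_pow (h.compact_seq n) (fun x hx => map_mem_genSup hx) hr hC h0
        (fun μ hμ y hy => mem_genSup_of_sub_mem hμ hy) hn k (y n)
    · simpa using (hk0.const_mul (C ^ k)).add tendsto_one_div_add_atTop_nhds_zero_nat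
  simpa using hy.sub hw0

/-- Convergence of the spectral subspaces of discretely convergent compact operators near a
nonzero point. -/
theorem DiscreteConv.exists_spectral_disc [CompleteSpace E₀] (h : DiscreteConv E En A An)
    (hEn : ∀ n, IsClosed (En n : Set E₀)) {μ₀ : ℂ} (hμ₀ : μ₀ ≠ 0) :
    ∃ r > 0, (∀ μ ∈ Metric.closedBall μ₀ r, μ ≠ 0) ∧
      (∀ ε > 0, ∀ᶠ n in atTop, Metric.closedBall μ₀ r ∩
        {μ | Module.End.HasEigenvalue (An n : Module.End ℂ (En n)) μ} ⊆ Metric.ball μ₀ ε) ∧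
      (∀ n, FiniteDimensional ℂ
        (genSup (An n : Module.End ℂ (En n)) (Metric.closedBall μ₀ r))) ∧
      (∀ᶠ n in atTop, Module.finrank ℂ
        (genSup (An n : Module.End ℂ (En n)) (Metric.closedBall μ₀ r)) =
          Module.finrank ℂ (Module.End.maxGenEigenspace (A : Module.End ℂ E) μ₀)) ∧
      (∀ x ∈ Module.End.maxGenEigenspace (A : Module.End ℂ E) μ₀, ∃ v : ∀ n, En n,
        (∀ n, v n ∈ genSup (An n : Module.End ℂ (En n)) (Metric.closedBall μ₀ r)) ∧
          Tendsto (fun n => (v n : E₀)) atTop (𝓝 (x : E₀))) ∧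
      ∀ U : Ultrafilter ℕ, ↑U ≤ (atTop : Filter ℕ) → ∀ (y : ∀ n, En n) (R : ℝ),
        (∀ᶠ n in U, y n ∈ genSup (An n : Module.End ℂ (En n)) (Metric.closedBall μ₀ r) ∧
          ‖y n‖ ≤ R) → ∃ x ∈ Module.End.maxGenEigenspace (A : Module.End ℂ E) μ₀,
            Tendsto (fun n => (y n : E₀)) U (𝓝 (x : E₀)) := by
  obtain ⟨r, hr, hlow, he⟩ := exists_closedBall_eigenvalue h.compact hμ₀
  have hpos : 0 < ‖μ₀‖ / 2 := half_pos (norm_pos_iff.2 hμ₀)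
  have h0 : ∀ μ ∈ Metric.closedBall μ₀ r, μ ≠ 0 := fun μ hμ =>
    norm_pos_iff.1 (hpos.trans_le (hlow μ hμ))
  have hfd : ∀ n, FiniteDimensional ℂ
      (genSup (An n : Module.End ℂ (En n)) (Metric.closedBall μ₀ r)) := fun n =>
    finiteDimensional_genSup (h.compact_seq n) hpos hlow
  have hev : ∀ ε > 0, ∀ᶠ n in atTop, Metric.closedBall μ₀ r ∩
      {μ | Module.End.HasEigenvalue (An n : Module.End ℂ (En n)) μ} ⊆ Metric.ball μ₀ ε :=
    fun ε hε => h.eventually_eigenvalues_subset (isCompact_closedBall μ₀ r) h0 he hε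
  have happ := fun x => h.exists_approx_mem_genSup hEn hr h0 he hfd (x := x)
  have hflag : ∀ n, IsFlag (An n) (Metric.closedBall μ₀ r ∩
      {μ | Module.End.HasEigenvalue (An n : Module.End ℂ (En n)) μ})
      (Module.finrank ℂ (genSup (An n : Module.End ℂ (En n)) (Metric.closedBall μ₀ r)))
      (genSup (An n : Module.End ℂ (En n)) (Metric.closedBall μ₀ r)) := by
    intro n
    rw [← genSup_inter_eigenvalues]
    have := hfd n
    rw [← genSup_inter_eigenvalues] at this
    exact isFlag_genSup _ _
  have hfin : ∀ᶠ n in atTop, Module.finrank ℂ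
      (genSup (An n : Module.End ℂ (En n)) (Metric.closedBall μ₀ r)) =
        Module.finrank ℂ (Module.End.maxGenEigenspace (A : Module.End ℂ E) μ₀) := by
    have hle : ∀ᶠ n in atTop, Module.finrank ℂ
        (genSup (An n : Module.End ℂ (En n)) (Metric.closedBall μ₀ r)) ≤
          Module.finrank ℂ (Module.End.maxGenEigenspace (A : Module.End ℂ E) μ₀) := by
      by_contra hcon
      obtain ⟨U, hU, hUn⟩ := exists_ultrafilter_of_not_eventually hcon
      -- The dimensions may vary with `n`, so every flag that is too long is truncated to the common
      -- length `dim L + 1`.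
      have : ∀ n, ∃ N, (¬ Module.finrank ℂ
          (genSup (An n : Module.End ℂ (En n)) (Metric.closedBall μ₀ r)) ≤
          Module.finrank ℂ (Module.End.maxGenEigenspace (A : Module.End ℂ E) μ₀)) →
          IsFlag (An n) (Metric.closedBall μ₀ r ∩
            {μ | Module.End.HasEigenvalue (An n : Module.End ℂ (En n)) μ})
            (Module.finrank ℂ (Module.End.maxGenEigenspace (A : Module.End ℂ E) μ₀) + 1) N := by
        intro n
        by_cases hn : Module.finrank ℂ
          (genSup (An n : Module.End ℂ (En n)) (Metric.closedBall μ₀ r)) ≤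
          Module.finrank ℂ (Module.End.maxGenEigenspace (A : Module.End ℂ E) μ₀)
        · exact ⟨⊥, fun h => absurd hn h⟩
        · obtain ⟨N, -, hN⟩ := (hflag n).exists_le _ (not_le.1 hn)
          exact ⟨N, fun _ => hN⟩
      choose N hN using this
      have := h.le_finrank_of_isFlag hU hμ₀ (fun ε hε => hU (hev ε hε))
        (hUn.mono fun n hn => hN n hn)
      omega
    have hge : ∀ᶠ n in atTop,
        Module.finrank ℂ (Module.End.maxGenEigenspace (A : Module.End ℂ E) μ₀) ≤
          Module.finrank ℂ (genSup (An n : Module.End ℂ (En n)) (Metric.closedBall μ₀ r)) := by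
      have := finiteDimensional_maxGenEigenspace h.compact hμ₀
      let b := Module.finBasis ℂ (Module.End.maxGenEigenspace (A : Module.End ℂ E) μ₀)
      choose v hvV hv using fun i => happ (b i) (b i).2
      have hb : LinearIndependent ℂ fun i => ((b i : E) : E₀) :=
        (b.linearIndependent.map' (Submodule.subtype _) (by simp)).map' E.subtype (by simp)
      have ht : Tendsto (fun n => fun i => (v i n : E₀)) atTop (𝓝 fun i => ((b i : E) : E₀)) :=
        tendsto_pi_nhds.2 hv
      -- Linear independence of a finite family is an open condition, so approximations to a basis
      -- of the limit space are eventually independent.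
      filter_upwards [ht.eventually hb.eventually] with n hn
      have h1 : LinearIndependent ℂ fun i => (⟨v i n, hvV i n⟩ :
          genSup (An n : Module.End ℂ (En n)) (Metric.closedBall μ₀ r)) :=
        LinearIndependent.of_comp ((En n).subtype ∘ₗ Submodule.subtype _) hn
      have := hfd n
      simpa using h1.fintype_card_le_finrank
    filter_upwards [hle, hge] with n h1 h2 using le_antisymm h1 h2
  refine ⟨r, hr, h0, hev, hfd, hfin, happ, fun U hU y R hy => ?_⟩
  refine h.exists_tendsto_of_isFlag hU hμ₀ (fun ε hε => hU (hev ε hε))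
    (Module.finrank ℂ (Module.End.maxGenEigenspace (A : Module.End ℂ E) μ₀)) _ ?_ y R hy
  filter_upwards [hU hfin] with n hn
  rw [← hn]
  exact hflag n

end DiscreteSpectrum

/-! ### Passing between an unbounded operator and its resolvent -/

section Resolvents

variable {F : Type*} [NormedAddCommGroup F] [NormedSpace ℂ F] {T : F →ₗ.[ℂ] F} {l w : ℂ}
  {A R : F →L[ℂ] F}

theorem IsResolventAt.injective (hA : IsResolventAt T l A) : Function.Injective A := by
  refine (injective_iff_map_eq_zero A).2 fun y hy => ?_
  obtain ⟨h, h1⟩ := hA.1 y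
  have h2 : (⟨A y, h⟩ : T.domain) = 0 := Subtype.ext hy
  rw [h2, hy, T.map_zero, smul_zero, sub_zero] at h1
  exact h1.symm

theorem IsResolventAt.sub_eq (hA : IsResolventAt T l A) (hR : IsResolventAt T w R) (y : F) :
    R y - A y = (w - l) • A (R y) := by
  obtain ⟨h, h1⟩ := hR.1 y
  have h2 := hA.2 ⟨R y, h⟩
  have h3 : T ⟨R y, h⟩ = y + w • R y := sub_eq_iff_eq_add.1 h1
  rw [h3] at h2
  simp only [map_sub, map_add, map_smul] at h2
  rw [sub_smul, sub_eq_iff_eq_add]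
  nth_rw 1 [← h2]
  abel

/-- Fredholm alternative for `A` at `μ = (w - l)⁻¹`. From `T - w = (1 - (w - l) A)(T - l)` on the
domain, the resolvent at `w` is `μ A (μ - A)⁻¹`. -/
theorem IsResolventAt.hasEigenvalue_or_exists [CompleteSpace F] (hA : IsResolventAt T l A)
    (hc : IsCompactOperator A) (w : ℂ) :
    Module.End.HasEigenvalue (A : Module.End ℂ F) (w - l)⁻¹ ∨ w ∈ resolventSet T := by
  by_cases hwl : w = l
  · exact Or.inr ⟨A, hwl ▸ hA⟩
  have h0 : w - l ≠ 0 := sub_ne_zero.2 hwl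
  refine (hc.hasEigenvalue_or_mem_resolventSet (inv_ne_zero h0)).imp_right fun hμ => ?_
  set S := _root_.resolvent A (w - l)⁻¹ with hS
  have hS1 := fun q => smul_sub_resolvent_apply hμ q
  have hS2 := fun q => resolvent_smul_sub_apply hμ q
  have hcomm : ∀ q, S (A q) = A (S q) := by
    intro q
    rw [← hS2 (A (S q))]
    congr 1
    conv_lhs => rw [← hS1 q]
    simp [hS]
  refine ⟨(w - l)⁻¹ • A.comp S, fun y => ?_, fun x => ?_⟩
  · have hdom := (hA.1 ((w - l)⁻¹ • S y))
    obtain ⟨h, h1⟩ := hdom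
    have h2 : ((w - l)⁻¹ • A.comp S) y = A ((w - l)⁻¹ • S y) := by simp
    rw [h2]
    refine ⟨h, ?_⟩
    have h3 : T ⟨A ((w - l)⁻¹ • S y), h⟩ =
        (w - l)⁻¹ • S y + l • A ((w - l)⁻¹ • S y) :=
      sub_eq_iff_eq_add.1 h1
    rw [h3]
    have h4 := hS1 y
    have h5 : (w - l)⁻¹ • S y + l • A ((w - l)⁻¹ • S y) - w • A ((w - l)⁻¹ • S y) =
        (w - l)⁻¹ • S y - (w - l) • A ((w - l)⁻¹ • S y) := by
      rw [sub_smul]; abel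
    rw [h5, map_smul, smul_inv_smul₀ h0]
    exact h4
  · have h1 := hA.2 x
    change (w - l)⁻¹ • A (S _) = _
    rw [← hcomm]
    have h2 : T x - w • (x : F) = (T x - l • (x : F)) - (w - l) • (x : F) := by
      rw [sub_smul]; abel
    rw [h2, map_sub, h1, map_smul, ← map_smul, smul_sub, inv_smul_smul₀ h0]
    have h3 := hS2 (x : F)
    exact h3

/-- On the domain `A (T - w) = -(w - l) (A - (w - l)⁻¹)`, where `A` is injective and commutes with
the right side. The domain condition is automatic: if `A x - (w - l)⁻¹ • x` lies in the domain, so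
does `x`. -/
theorem IsResolventAt.mem_kerPow_iff (hA : IsResolventAt T l A) (hw : w ≠ l) (k : ℕ) :
    ∀ x : F, x ∈ kerPow T w k ↔ (((A : Module.End ℂ F) - (w - l)⁻¹ • (1 : Module.End ℂ F)) ^ k) x = 0 := by
  have h0 : w - l ≠ 0 := sub_ne_zero.2 hw
  have hdom : ∀ k, ∀ x ∈ kerPow T w k, x ∈ T.domain := by
    intro k x hx
    cases k with
    | zero => rw [(Submodule.mem_bot ℂ).1 hx]; exact zero_mem _
    | succ k =>
      obtain ⟨y, -, rfl⟩ := hx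
      exact y.2
  have hcomm : ∀ (k : ℕ) (x : F), (((A : Module.End ℂ F) - (w - l)⁻¹ • (1 : Module.End ℂ F)) ^ k) (A x) =
      A ((((A : Module.End ℂ F) - (w - l)⁻¹ • (1 : Module.End ℂ F)) ^ k) x) := by
    intro k x
    have h1 : Commute (((A : Module.End ℂ F) - (w - l)⁻¹ • (1 : Module.End ℂ F)) ^ k) (A : Module.End ℂ F) :=
      (((Commute.refl _).sub_left ((Commute.one_left _).smul_left _)).pow_left k)
    exact congrArg (fun f : Module.End ℂ F => f x) h1.eq
  have hsucc : ∀ (k : ℕ) (x : F), (((A : Module.End ℂ F) - (w - l)⁻¹ • (1 : Module.End ℂ F)) ^ (k + 1)) x =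
      (((A : Module.End ℂ F) - (w - l)⁻¹ • (1 : Module.End ℂ F)) ^ k) (A x - (w - l)⁻¹ • x) := by
    intro k x
    rw [pow_succ]
    rfl
  have hkey : ∀ x : T.domain, A (T x - w • (x : F)) =
      -(w - l) • (A (x : F) - (w - l)⁻¹ • (x : F)) := by
    intro x
    have h1 := hA.2 x
    have h2 : T x - w • (x : F) = (T x - l • (x : F)) - (w - l) • (x : F) := by
      rw [sub_smul]; abel
    rw [h2, map_sub, h1, map_smul, neg_smul, smul_sub, smul_inv_smul₀ h0]
    abel
  induction k with
  | zero => intro x; exact Submodule.mem_bot ℂ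
  | succ k ih =>
    have hmem : ∀ x : T.domain, T x - w • (x : F) ∈ kerPow T w k ↔
        (((A : Module.End ℂ F) - (w - l)⁻¹ • (1 : Module.End ℂ F)) ^ (k + 1)) x = 0 := by
      intro x
      rw [ih, hsucc, ← hA.injective.eq_iff, ← hcomm, hkey, map_smul, map_zero,
        smul_eq_zero_iff_right (neg_ne_zero.2 h0)]
    intro x
    constructor
    · rintro ⟨y, hy, rfl⟩
      exact (hmem y).1 hy
    · intro hx
      have hx' := hx
      rw [hsucc] at hx'
      have h1 := hdom k _ ((ih _).2 hx')
      have h2 : x ∈ T.domain := by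
        obtain ⟨h3, -⟩ := hA.1 x
        have h4 := T.domain.smul_mem (w - l) (sub_mem h3 h1)
        rwa [sub_sub_cancel, smul_inv_smul₀ h0] at h4
      exact ⟨⟨x, h2⟩, (hmem ⟨x, h2⟩).2 hx, rfl⟩

theorem IsResolventAt.algEigenspace_eq (hA : IsResolventAt T l A) (hw : w ≠ l) :
    algEigenspace T w = Module.End.maxGenEigenspace (A : Module.End ℂ F) (w - l)⁻¹ := by
  rw [algEigenspace, ← Module.End.iSup_genEigenspace_eq]
  congr 1
  ext k x
  rw [hA.mem_kerPow_iff hw, Module.End.mem_genEigenspace_nat, LinearMap.mem_ker]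

/-- The case `w = l` needs no exclusion: there `(w - l)⁻¹` is `0` by convention, which is not an
eigenvalue of the injective `A`, just as `l` is not one of `T`. -/
theorem IsResolventAt.isEigenvalue_iff (hA : IsResolventAt T l A) :
    IsEigenvalue T w ↔ Module.End.HasEigenvalue (A : Module.End ℂ F) (w - l)⁻¹ := by
  constructor
  · rintro ⟨x, hx0, hx⟩
    have h1 := hA.2 x
    have h0 : w - l ≠ 0 := by
      intro h
      rw [hx, ← sub_smul, h, zero_smul, map_zero] at h1
      exact hx0 h1.symm
    refine Module.End.hasEigenvalue_of_hasEigenvector (x := x) ⟨?_, hx0⟩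
    rw [Module.End.mem_eigenspace_iff]
    change A x = _
    rw [hx, ← sub_smul, map_smul] at h1
    rw [eq_inv_smul_iff₀ h0]
    exact h1
  · intro h
    obtain ⟨x, hx, hx0⟩ := h.exists_hasEigenvector
    rw [Module.End.mem_eigenspace_iff] at hx
    have hx' : A x = (w - l)⁻¹ • x := hx
    have h0 : w - l ≠ 0 := by
      intro h
      rw [h, inv_zero, zero_smul] at hx'
      exact hx0 (hA.injective (by rw [hx', map_zero]))
    obtain ⟨h1, h2⟩ := hA.1 x
    refine ⟨⟨A x, h1⟩, fun h => hx0 (hA.injective (by rw [map_zero]; exact h)), ?_⟩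
    have h3 : x = (w - l) • A x := by rw [hx', smul_inv_smul₀ h0]
    have h4 : T ⟨A x, h1⟩ = x + l • A x := sub_eq_iff_eq_add.1 h2
    rw [h4]
    change x + l • A x = w • A x
    nth_rw 1 [h3]
    rw [sub_smul]; abel

theorem not_isEigenvalue_of_mem_resolventSet (h : w ∈ resolventSet T) : ¬ IsEigenvalue T w := by
  rintro ⟨x, hx0, hx⟩
  obtain ⟨R, hR⟩ := h
  have := hR.2 x
  rw [hx, sub_self, map_zero] at this
  exact hx0 this.symm

theorem IsResolventAt.mem_spectrum_iff [CompleteSpace F] (hA : IsResolventAt T l A)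
    (hc : IsCompactOperator A) :
    w ∈ spectrum T ↔ Module.End.HasEigenvalue (A : Module.End ℂ F) (w - l)⁻¹ := by
  constructor
  · exact fun h => (hA.hasEigenvalue_or_exists hc w).resolve_right h
  · exact fun h h' => not_isEigenvalue_of_mem_resolventSet h' (hA.isEigenvalue_iff.2 h)

theorem IsResolventAt.isCompactOperator (hA : IsResolventAt T l A) (hR : IsResolventAt T w R)
    (hc : IsCompactOperator A) : IsCompactOperator R := by
  have : R = A + (w - l) • A.comp R := by
    ext y
    have := hA.sub_eq hR y
    rw [sub_eq_iff_eq_add] at this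
    simpa [add_comm] using this
  rw [this]
  exact hc.add ((hc.comp_clm R).smul _)

end Resolvents

/-! ### Discrete compactness along ultrafilters; convergence of resolvents -/

section Convergence

section Subsequences

theorem exists_subset_tendsto {X : Type*} [PseudoMetricSpace X] {U : Ultrafilter ℕ}
    (hU : ↑U ≤ (atTop : Filter ℕ)) {I : Set ℕ} (hI : I ∈ U) {a : ℕ → X} {x : X}
    (h : Tendsto a U (𝓝 x)) :
    ∃ J ⊆ I, J.Infinite ∧ Tendsto a (atTop ⊓ 𝓟 J) (𝓝 x) := by
  have hfreq : ∀ k : ℕ, ∃ᶠ n in atTop, n ∈ I ∧ dist (a n) x < 1 / ((k : ℝ) + 1) := fun k =>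
    (Eventually.frequently (f := (U : Filter ℕ))
      (Filter.Eventually.and hI (Metric.tendsto_nhds.1 h _ (by positivity)))).filter_mono hU
  obtain ⟨ψ, hψ, hψk⟩ := extraction_forall_of_frequently hfreq
  refine ⟨Set.range ψ, ?_, Set.infinite_range_of_injective hψ.injective, ?_⟩
  · rintro _ ⟨k, rfl⟩
    exact (hψk k).1
  · rw [← Nat.cofinite_eq_atTop, ← Filter.map_comap, hψ.injective.comap_cofinite_eq,
      Nat.cofinite_eq_atTop, tendsto_map'_iff, tendsto_iff_dist_tendsto_zero]
    exact squeeze_zero (fun k => dist_nonneg) (fun k => (hψk k).2.le)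
      tendsto_one_div_add_atTop_nhds_zero_nat

theorem neBot_atTop_inf_principal {J : Set ℕ} (hJ : J.Infinite) :
    (atTop ⊓ 𝓟 J : Filter ℕ).NeBot := by
  rw [← Filter.frequently_mem_iff_neBot, Nat.frequently_atTop_iff_infinite]
  exact hJ

end Subsequences

variable {E₀ : Type*} [NormedAddCommGroup E₀] [NormedSpace ℂ E₀] {E : Submodule ℂ E₀}
  {En : ℕ → Submodule ℂ E₀} {A : E →L[ℂ] E} {An : ∀ n, En n →L[ℂ] En n}

/-- If the images were not Cauchy along `U`, no ball of radius `ε / 2` would belong to the image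
ultrafilter. One could then pick an `ε / 2`-separated sequence of images, against discrete
compactness. -/
theorem DiscretelyCompact.exists_lim [CompleteSpace E₀] (h : DiscretelyCompact E An)
    {U : Ultrafilter ℕ} (hU : ↑U ≤ (atTop : Filter ℕ)) (x : ∀ n, En n) (M : ℝ)
    (hx : ∀ᶠ n in U, ‖x n‖ ≤ M) :
    ∃ y : E, Tendsto (fun n => (An n (x n) : E₀)) U (𝓝 (y : E₀)) := by
  set a : ℕ → E₀ := fun n => (An n (x n) : E₀)
  set I : Set ℕ := {n | ‖x n‖ ≤ M}
  have hcau : Cauchy (map a (U : Filter ℕ)) := by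
    by_contra hcon
    rw [Metric.cauchy_iff] at hcon
    have hne : (map a (U : Filter ℕ)).NeBot := inferInstance
    simp only [hne, true_and] at hcon
    push Not at hcon
    obtain ⟨ε, hε, hcon⟩ := hcon
    have hfar : ∀ c : E₀, ∀ᶠ n in (U : Filter ℕ), ε / 2 ≤ dist (a n) c := by
      intro c
      by_contra hc
      rw [← Ultrafilter.eventually_not] at hc
      obtain ⟨p, hp, q, hq, hpq⟩ := hcon (Metric.ball c (ε / 2)) (Filter.mem_map.2
        (hc.mono fun n hn => not_le.1 hn))
      have := dist_triangle_right p q c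
      rw [Metric.mem_ball] at hp hq
      linarith
    obtain ⟨u, hu⟩ := Set.seq_of_forall_finite_exists
      (P := fun n t => n ∈ I ∧ ∀ m ∈ t, ε / 2 ≤ dist (a n) (a m) ∧ m < n) (by
        intro t ht
        have h1 : ∀ᶠ n in (U : Filter ℕ), ∀ m ∈ t, ε / 2 ≤ dist (a n) (a m) ∧ m < n :=
          (eventually_all_finite ht).2 fun m _ => (hfar (a m)).and (hU (eventually_gt_atTop m))
        exact (Filter.Eventually.and hx h1).exists)
    have hmono : StrictMono u := fun i j hij => ((hu j).2 _ ⟨i, hij, rfl⟩).2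
    obtain ⟨y, J, hJ, hJi, hy⟩ := h (Set.range u) (Set.infinite_range_of_injective hmono.injective)
      x ⟨M, by rintro _ ⟨k, rfl⟩; exact (hu k).1⟩
    have h1 := Metric.tendsto_nhds.1 hy (ε / 4) (by positivity)
    rw [eventually_inf_principal, eventually_atTop] at h1
    obtain ⟨N, hN⟩ := h1
    obtain ⟨n, hnJ, hn⟩ := hJi.exists_gt N
    obtain ⟨m, hmJ, hm⟩ := hJi.exists_gt n
    have hn' := hN n hn.le hnJ
    have hm' := hN m (hn.trans hm).le hmJ
    obtain ⟨i, rfl⟩ := hJ hnJ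
    obtain ⟨j, rfl⟩ := hJ hmJ
    have h2 := ((hu j).2 _ ⟨i, hmono.lt_iff_lt.1 hm, rfl⟩).1
    have h3 := dist_triangle_right (a (u j)) (a (u i)) (y : E₀)
    linarith
  obtain ⟨y₀, hy₀⟩ := CompleteSpace.complete hcau
  -- Completeness gives a limit only in `E₀`. Discrete compactness along a subsequence with the same
  -- limit places it in `E`.
  obtain ⟨J, hJI, hJ, hJt⟩ := exists_subset_tendsto hU hx (a := a) hy₀
  obtain ⟨y, J', hJ'J, hJ', hy⟩ := h J hJ x ⟨M, fun n hn => hJI hn⟩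
  have := neBot_atTop_inf_principal hJ'
  have h1 := tendsto_nhds_unique hy
    (hJt.mono_left (inf_le_inf_left _ (principal_mono.2 hJ'J)))
  exact ⟨y, by rw [h1]; exact hy₀⟩

/-- Banach–Steinhaus applies to `An n ∘ Pn n` on the fixed space `E₀`. Since `Pn n` is the identity
on `En n`, the bound passes to `An n` without a factor `‖Pn n‖`. -/
theorem StrongConv.exists_bound [CompleteSpace E₀] {P : E₀ →L[ℂ] E} {Pn : ∀ n, E₀ →L[ℂ] En n}
    (hPn : ∀ n, IsProjectionOnto (En n) (Pn n)) (h : StrongConv P Pn A An) :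
    ∃ C : ℝ, 0 ≤ C ∧ ∀ n, ∀ x : En n, ‖An n x‖ ≤ C * ‖x‖ := by
  obtain ⟨C, hC⟩ := banach_steinhaus
    (g := fun n => (En n).subtypeL.comp ((An n).comp (Pn n))) (fun x => by
      obtain ⟨C, hC⟩ := (h x).norm.bddAbove_range
      exact ⟨C, fun n => hC ⟨n, rfl⟩⟩)
  refine ⟨C, (norm_nonneg _).trans (hC 0), fun n x => ?_⟩
  have h1 := ContinuousLinearMap.le_of_opNorm_le _ (hC n) (x : E₀)
  simp only [ContinuousLinearMap.comp_apply, hPn n x] at h1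
  exact h1

theorem DiscreteConv.of_strongConv [CompleteSpace E₀] {P : E₀ →L[ℂ] E} {Pn : ∀ n, E₀ →L[ℂ] En n}
    (hP : IsProjectionOnto E P) (hPn : ∀ n, IsProjectionOnto (En n) (Pn n))
    (hPconv : ∀ x : E₀, Tendsto (fun n => (Pn n x : E₀)) atTop (𝓝 (P x : E₀)))
    (h : StrongConv P Pn A An) (hA : IsCompactOperator A) (hAn : ∀ n, IsCompactOperator (An n))
    (hlim : ∀ U : Ultrafilter ℕ, ↑U ≤ (atTop : Filter ℕ) → ∀ (x : ∀ n, En n) (M : ℝ),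
      (∀ᶠ n in U, ‖x n‖ ≤ M) → ∃ y : E, Tendsto (fun n => (An n (x n) : E₀)) U (𝓝 (y : E₀))) :
    DiscreteConv E En A An where
  compact := hA
  compact_seq := hAn
  approx x := ⟨fun n => Pn n x, by simpa [hP x] using hPconv x⟩
  tendsto l hl x y hxy := by
    obtain ⟨C, hC, hbd⟩ := h.exists_bound hPn
    have h1 := (h y).mono_left hl
    have h2 := (hPconv y).mono_left hl
    rw [hP y] at h1 h2
    have h3 : Tendsto (fun n => (An n (x n - Pn n y) : E₀)) l (𝓝 0) := by
      refine squeeze_zero_norm (fun n => hbd n _) ?_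
      have := ((hxy.sub h2).norm).const_mul C
      simpa using this
    simpa using h1.add h3
  exists_lim := hlim

section Operators

variable {T : E →ₗ.[ℂ] E} {Tn : ∀ n, En n →ₗ.[ℂ] En n} {l z : ℂ}

theorem IsResolventAt.resolvent_eq {F : Type*} [NormedAddCommGroup F] [NormedSpace ℂ F]
    {T : F →ₗ.[ℂ] F} {z : ℂ} {R : F →L[ℂ] F} (h : IsResolventAt T z R) : resolvent T z = R :=
  (isResolventAt_resolvent ⟨R, h⟩).unique h

/-- The equation `(A - (z - l)⁻¹) R = -(z - l)⁻¹ A` for resolvents `A`, `R` at `l`, `z`. -/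
theorem IsResolventAt.apply_sub_smul {F : Type*} [NormedAddCommGroup F] [NormedSpace ℂ F]
    {T : F →ₗ.[ℂ] F} {l z : ℂ} {A R : F →L[ℂ] F} (hA : IsResolventAt T l A)
    (hR : IsResolventAt T z R) (hz : z ≠ l) (y : F) :
    A (R y) - (z - l)⁻¹ • R y = -((z - l)⁻¹ • A y) := by
  have h0 : z - l ≠ 0 := sub_ne_zero.2 hz
  have h1 := hA.sub_eq hR y
  have h2 : A (R y) = (z - l)⁻¹ • (R y - A y) := by rw [h1, inv_smul_smul₀ h0]
  rw [h2, smul_sub]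
  abel

theorem DiscreteConv.strongConv_resolvent [CompleteSpace E₀] (h : DiscreteConv E En A An)
    (hE : IsClosed (E : Set E₀)) (hEn : ∀ n, IsClosed (En n : Set E₀))
    {P : E₀ →L[ℂ] E} {Pn : ∀ n, E₀ →L[ℂ] En n}
    (hP : IsProjectionOnto E P) (hPn : ∀ n, IsProjectionOnto (En n) (Pn n))
    (hPconv : ∀ x : E₀, Tendsto (fun n => (Pn n x : E₀)) atTop (𝓝 (P x : E₀)))
    (hs : StrongConv P Pn A An) (hA : IsResolventAt T l A)
    (hAn : ∀ᶠ n in atTop, IsResolventAt (Tn n) l (An n)) (hz : z ∈ resolventSet T) :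
    z ∈ regionOfBoundedness Tn ∧
      StrongConv P Pn (resolvent T z) (fun n => resolvent (Tn n) z) := by
  have hcE : CompleteSpace E := hE.completeSpace_coe
  have hcl : ∀ n, CompleteSpace (En n) := fun n => (hEn n).completeSpace_coe
  obtain ⟨M, hM, hbd⟩ := hs.exists_bound hPn
  by_cases hzl : z = l
  · subst hzl
    constructor
    · obtain ⟨n₀, hn₀⟩ := eventually_atTop.1 hAn
      refine ⟨n₀, fun n hn => ⟨_, hn₀ n hn⟩, M, fun n hn => ?_⟩
      rw [(hn₀ n hn).resolvent_eq]
      exact ContinuousLinearMap.opNorm_le_bound _ hM (hbd n)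
    · intro x
      rw [hA.resolvent_eq]
      refine (hs x).congr' ?_
      filter_upwards [hAn] with n hn
      rw [hn.resolvent_eq]
  have h0 : z - l ≠ 0 := sub_ne_zero.2 hzl
  have hne : ¬ Module.End.HasEigenvalue (A : Module.End ℂ E) (z - l)⁻¹ := fun he =>
    (hA.mem_spectrum_iff h.compact).2 he hz
  obtain ⟨C, hC, hlow⟩ := h.exists_lower_bound (K := {(z - l)⁻¹}) isCompact_singleton
    (by simpa using h0) (by simpa using hne)
  have hRn : ∀ᶠ n in atTop, z ∈ resolventSet (Tn n) := by
    filter_upwards [hAn, hlow] with n hn hl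
    refine (hn.hasEigenvalue_or_exists (h.compact_seq n) z).resolve_left fun he => ?_
    obtain ⟨x, hx, hx0⟩ := he.exists_hasEigenvector
    rw [Module.End.mem_eigenspace_iff] at hx
    have h1 := hl _ rfl x
    have h2 : An n x - (z - l)⁻¹ • x = 0 := sub_eq_zero.2 hx
    rw [h2, norm_zero, mul_zero] at h1
    exact hx0 (norm_le_zero_iff.1 h1)
  have heq : ∀ᶠ n in atTop, ∀ y, An n (resolvent (Tn n) z y) - (z - l)⁻¹ • resolvent (Tn n) z y =
      -((z - l)⁻¹ • An n y) := by
    filter_upwards [hAn, hRn] with n h1 h2 y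
    exact h1.apply_sub_smul (isResolventAt_resolvent h2) hzl y
  constructor
  · obtain ⟨n₀, hn₀⟩ := eventually_atTop.1 (hlow.and (hRn.and heq))
    refine ⟨n₀, fun n hn => (hn₀ n hn).2.1, C * (‖(z - l)⁻¹‖ * M), fun n hn => ?_⟩
    refine ContinuousLinearMap.opNorm_le_bound _ (by positivity) fun y => ?_
    refine ((hn₀ n hn).1 _ rfl _).trans ?_
    rw [(hn₀ n hn).2.2, norm_neg, norm_smul, mul_assoc, mul_assoc]
    gcongr
    exact hbd n y
  · intro x
    set u := resolvent T z (P x)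
    have hequ : A u - (z - l)⁻¹ • u = -((z - l)⁻¹ • A (P x)) :=
      hA.apply_sub_smul (isResolventAt_resolvent hz) hzl (P x)
    have hPu := hPconv u
    rw [hP u] at hPu
    have hAu := h.tendsto _ le_rfl _ _ hPu
    -- Stability and consistency: `Pn n u` satisfies the equation for `resolvent (Tn n) z (Pn n x)`
    -- up to a residual tending to zero, and the lower bound turns this into convergence of the
    -- difference.
    have hlim : Tendsto (fun n => ((-((z - l)⁻¹ • An n (Pn n x)) -
        (An n (Pn n u) - (z - l)⁻¹ • Pn n u) : En n) : E₀)) atTop (𝓝 0) := by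
      have h1 := (((hs x).const_smul (z - l)⁻¹).neg).sub (hAu.sub (hPu.const_smul (z - l)⁻¹))
      have h2 : -((z - l)⁻¹ • (A (P x) : E₀)) - ((A u : E₀) - (z - l)⁻¹ • (u : E₀)) = 0 := by
        have := congrArg (Subtype.val) hequ
        simp only [Submodule.coe_sub, Submodule.coe_smul, Submodule.coe_neg] at this
        rw [this, sub_self]
      rw [h2] at h1
      simpa using h1
    have hdiff : Tendsto (fun n => ((resolvent (Tn n) z (Pn n x) - Pn n u : En n) : E₀)) atTop
        (𝓝 0) := by
      refine squeeze_zero_norm' (a := fun n => C * ‖((-((z - l)⁻¹ • An n (Pn n x)) -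
        (An n (Pn n u) - (z - l)⁻¹ • Pn n u) : En n) : E₀)‖) ?_ ?_
      · filter_upwards [hlow, heq] with n h1 h2
        have h3 := h1 _ rfl (resolvent (Tn n) z (Pn n x) - Pn n u)
        rw [map_sub, smul_sub, sub_sub_sub_comm, h2] at h3
        exact h3
      · simpa using hlim.norm.const_mul C
    simpa using hdiff.add hPu

/-- If `z` were in the spectrum, approximations `y n` of an eigenvector would have residuals `y n -
(z - l) • An n (y n)` tending to zero. Bounded resolvents at `z` would then force `y n` to tend to
zero. -/
theorem DiscreteConv.mem_resolventSet_of_mem_regionOfBoundedness [CompleteSpace E₀]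
    (h : DiscreteConv E En A An) (hE : IsClosed (E : Set E₀)) (hA : IsResolventAt T l A)
    (hAn : ∀ᶠ n in atTop, IsResolventAt (Tn n) l (An n)) (hz : z ∈ regionOfBoundedness Tn) :
    z ∈ resolventSet T := by
  have hcE : CompleteSpace E := hE.completeSpace_coe
  by_contra hzT
  have hzl : z ≠ l := by
    rintro rfl
    exact hzT ⟨A, hA⟩
  have h0 : z - l ≠ 0 := sub_ne_zero.2 hzl
  obtain ⟨x, hx, hx0⟩ := ((hA.mem_spectrum_iff h.compact).1 hzT).exists_hasEigenvector
  rw [Module.End.mem_eigenspace_iff] at hx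
  have hx' : A x = (z - l)⁻¹ • x := hx
  obtain ⟨y, hy⟩ := h.approx x
  have hAy := h.tendsto _ le_rfl _ _ hy
  obtain ⟨n₀, hn₀, M, hM⟩ := hz
  have hM0 : 0 ≤ M := (norm_nonneg _).trans (hM n₀ le_rfl)
  have hlim : Tendsto (fun n => ((y n - (z - l) • An n (y n) : En n) : E₀)) atTop (𝓝 0) := by
    have h1 := hy.sub (hAy.const_smul (z - l))
    rw [hx', Submodule.coe_smul, smul_inv_smul₀ h0, sub_self] at h1
    simpa using h1
  have hy0 : Tendsto (fun n => (y n : E₀)) atTop (𝓝 0) := by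
    refine squeeze_zero_norm' (a := fun n => (1 + ‖z - l‖ * M) *
      ‖((y n - (z - l) • An n (y n) : En n) : E₀)‖) ?_ ?_
    · filter_upwards [hAn, eventually_ge_atTop n₀] with n h1 h2
      have hR := isResolventAt_resolvent (hn₀ n h2)
      have h3 := hR.sub_eq h1 (y n)
      set v := y n - (z - l) • An n (y n) with hv
      -- By the resolvent identity, `1 + (z - l) R` with `R = resolvent (Tn n) z` inverts `1 - (z -
      -- l) An n`.
      have h4 : y n = v + (z - l) • resolvent (Tn n) z v := by
        rw [hv, map_sub, map_smul]
        have : resolvent (Tn n) z (y n) =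
            An n (y n) + (z - l) • resolvent (Tn n) z (An n (y n)) := by
          rw [← sub_eq_iff_eq_add', ← neg_sub, h3, ← neg_smul, neg_sub]
        rw [this]
        simp only [smul_add, smul_sub]
        abel
      calc ‖(y n : E₀)‖ = ‖v + (z - l) • resolvent (Tn n) z v‖ := congrArg (fun w : En n => ‖w‖) h4
        _ ≤ ‖v‖ + ‖(z - l) • resolvent (Tn n) z v‖ := norm_add_le _ _
        _ ≤ ‖v‖ + ‖z - l‖ * (M * ‖v‖) := by
            rw [norm_smul]
            gcongr
            exact ContinuousLinearMap.le_of_opNorm_le _ (hM n h2) v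
        _ = (1 + ‖z - l‖ * M) * ‖v‖ := by ring
    · simpa using hlim.norm.const_mul (1 + ‖z - l‖ * M)
  exact hx0 (Subtype.ext (tendsto_nhds_unique hy hy0))

theorem DiscreteConv.not_isSpurious [CompleteSpace E₀] (h : DiscreteConv E En A An)
    (hE : IsClosed (E : Set E₀)) (hEn : ∀ n, IsClosed (En n : Set E₀))
    {M : ℝ} (hbd : ∀ n, ∀ x : En n, ‖An n x‖ ≤ M * ‖x‖) (hA : IsResolventAt T l A)
    (hAn : ∀ᶠ n in atTop, IsResolventAt (Tn n) l (An n)) : ¬ IsSpurious T Tn z := by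
  have hcE : CompleteSpace E := hE.completeSpace_coe
  have hcl : ∀ n, CompleteSpace (En n) := fun n => (hEn n).completeSpace_coe
  rintro ⟨hz, I, hI, u, hu, hlim⟩
  have := neBot_atTop_inf_principal hI
  have hev : ∀ᶠ n in atTop ⊓ 𝓟 I,
      Module.End.HasEigenvalue (An n : Module.End ℂ (En n)) (u n - l)⁻¹ := by
    rw [eventually_inf_principal]
    filter_upwards [hAn] with n hn hnI
    exact (hn.mem_spectrum_iff (h.compact_seq n)).1 (hu n hnI)
  -- The uniform bound on the `An n` bounds their eigenvalues `(u n - l)⁻¹`, so the `u n` cannot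
  -- accumulate at `l`.
  have hle : ∀ᶠ n in atTop ⊓ 𝓟 I, 1 ≤ M * ‖u n - l‖ := by
    filter_upwards [hev, mem_inf_of_left hAn] with n h1 h2
    obtain ⟨x, hx, hx0⟩ := h1.exists_hasEigenvector
    rw [Module.End.mem_eigenspace_iff] at hx
    have hx' : An n x = (u n - l)⁻¹ • x := hx
    have hne : u n - l ≠ 0 := by
      intro h0
      rw [h0, inv_zero, zero_smul] at hx'
      exact hx0 (h2.injective (by rw [hx', map_zero]))
    have h3 := hbd n x
    rw [hx', norm_smul, norm_inv] at h3
    have h4 := le_of_mul_le_mul_right h3 (norm_pos_iff.2 hx0)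
    rwa [inv_le_iff_one_le_mul₀ (norm_pos_iff.2 hne)] at h4
  have hlim' : Tendsto (fun n => u n - l) (atTop ⊓ 𝓟 I) (𝓝 (z - l)) := hlim.sub_const l
  have h1 : 1 ≤ M * ‖z - l‖ := ge_of_tendsto (hlim'.norm.const_mul M) hle
  have h0 : z - l ≠ 0 := by
    intro h0
    rw [h0, norm_zero, mul_zero] at h1
    norm_num at h1
  obtain ⟨U, hU⟩ := Ultrafilter.exists_le (atTop ⊓ 𝓟 I)
  exact hz ((hA.mem_spectrum_iff h.compact).2 (h.hasEigenvalue_of_tendsto (hU.trans inf_le_left)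
    (inv_ne_zero h0) ((hlim'.inv₀ h0).mono_left hU) (hU hev)))

end Operators

end Convergence

/-! ### Algebraic multiplicities and eigenvalue lists -/

section Eigenvalues

variable {E₀ : Type*} [NormedAddCommGroup E₀] [NormedSpace ℂ E₀] {E : Submodule ℂ E₀}
  {En : ℕ → Submodule ℂ E₀} {A : E →L[ℂ] E} {An : ∀ n, En n →L[ℂ] En n}
  {T : E →ₗ.[ℂ] E} {Tn : ∀ n, En n →ₗ.[ℂ] En n} {l z : ℂ}

theorem algMult_eq_finrank {F : Type*} [NormedAddCommGroup F] [NormedSpace ℂ F]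
    {T : F →ₗ.[ℂ] F} {z : ℂ} [FiniteDimensional ℂ (algEigenspace T z)] :
    algMult T z = Module.finrank ℂ (algEigenspace T z) := by
  rw [algMult, ← Module.finrank_eq_rank, Cardinal.toENat_nat]

theorem algMult_eq_zero_of_not_isEigenvalue {F : Type*} [NormedAddCommGroup F] [NormedSpace ℂ F]
    {T : F →ₗ.[ℂ] F} {z : ℂ} (h : ¬ IsEigenvalue T z) : algMult T z = 0 := by
  have hk : ∀ k, kerPow T z k = ⊥ := by
    intro k
    induction k with
    | zero => rfl
    | succ k ih =>
      refine (Submodule.eq_bot_iff _).2 ?_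
      rintro _ ⟨x, hx, rfl⟩
      by_contra hx0
      refine h ⟨x, hx0, ?_⟩
      have h1 : T x - z • (x : F) ∈ kerPow T z k := hx
      rw [ih, Submodule.mem_bot] at h1
      exact sub_eq_zero.1 h1
  have : algEigenspace T z = ⊥ := by
    rw [algEigenspace]
    simp [hk]
  rw [algMult, this, rank_bot, map_zero]

theorem isEigenvalue_ne_zero_algMult {F : Type*} [NormedAddCommGroup F] [NormedSpace ℂ F]
    {T : F →ₗ.[ℂ] F} {z : ℂ} (h : IsEigenvalue T z) : algMult T z ≠ 0 := by
  obtain ⟨x, hx0, hx⟩ := h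
  have hmem : (x : F) ∈ algEigenspace T z := by
    refine (le_iSup (kerPow T z) 1) ⟨x, ?_, rfl⟩
    change T x - z • (x : F) ∈ kerPow T z 0
    rw [hx, sub_self]
    exact zero_mem _
  intro h0
  rw [algMult, Cardinal.toENat_eq_zero, rank_zero_iff_forall_zero] at h0
  exact hx0 (congrArg Subtype.val (h0 ⟨x, hmem⟩))

theorem unitVectorsConverge_of_ultrafilter [CompleteSpace E₀] {L : Submodule ℂ E}
    {Ln Vn : ∀ n, Submodule ℂ (En n)} (hLV : ∀ᶠ n in atTop, Ln n = Vn n)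
    (happ : ∀ x ∈ L, ∃ v : ∀ n, En n, (∀ n, v n ∈ Vn n) ∧
      Tendsto (fun n => (v n : E₀)) atTop (𝓝 (x : E₀)))
    (hlim : ∀ U : Ultrafilter ℕ, ↑U ≤ (atTop : Filter ℕ) → ∀ (y : ∀ n, En n) (R : ℝ),
      (∀ᶠ n in U, y n ∈ Vn n ∧ ‖y n‖ ≤ R) →
        ∃ x ∈ L, Tendsto (fun n => (y n : E₀)) U (𝓝 (x : E₀))) :
    UnitVectorsConverge L Ln := by
  constructor
  · intro x hx hx1
    obtain ⟨v, hvV, hv⟩ := happ x hx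
    have hx1' : ‖(x : E₀)‖ = 1 := hx1
    have hx0 : (x : E₀) ≠ 0 := norm_ne_zero_iff.1 (by rw [hx1']; exact one_ne_zero)
    refine ⟨fun n => ((‖v n‖⁻¹ : ℝ) : ℂ) • v n, ?_, ?_⟩
    · filter_upwards [hLV, hv.eventually_ne hx0] with n h1 h2
      refine ⟨?_, ?_⟩
      · rw [h1]; exact Submodule.smul_mem _ _ (hvV n)
      · rw [Complex.ofReal_inv]
        exact norm_smul_inv_norm fun h => h2 (by rw [h]; rfl)
    · have h1 := hv.norm.inv₀ (norm_ne_zero_iff.2 hx0)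
      have h2 := ((Complex.continuous_ofReal.tendsto _).comp h1).smul hv
      rw [hx1', inv_one, Complex.ofReal_one, one_smul] at h2
      exact h2
  · intro I hI y hy
    have := neBot_atTop_inf_principal hI
    obtain ⟨U, hU⟩ := Ultrafilter.exists_le (atTop ⊓ 𝓟 I)
    have hUt : (U : Filter ℕ) ≤ atTop := hU.trans inf_le_left
    have hIU : I ∈ (U : Filter ℕ) := hU (mem_inf_of_right (mem_principal_self I))
    have hev : ∀ᶠ n in U, y n ∈ Vn n ∧ ‖y n‖ = 1 := by
      filter_upwards [hIU, hUt hLV] with n h1 h2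
      rw [← h2]
      exact hy n h1
    obtain ⟨x, hx, hxt⟩ := hlim U hUt y 1 (hev.mono fun n hn => ⟨hn.1, hn.2.le⟩)
    refine ⟨x, hx, ?_, exists_subset_tendsto hUt hIU hxt⟩
    exact tendsto_nhds_unique hxt.norm
      (tendsto_const_nhds.congr' (hev.mono fun n hn => hn.2.symm))

/-- `U` is the preimage under `w ↦ (w - l)⁻¹` of the spectral disc of `A` at `(z - l)⁻¹`. The
eigenvalues `v n j` of `An n` in that disc, listed with multiplicity, are pulled back to `l + (v n
j)⁻¹`. -/
theorem DiscreteConv.exists_eigenvalue_enumeration [CompleteSpace E₀]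
    (h : DiscreteConv E En A An) (hEn : ∀ n, IsClosed (En n : Set E₀)) (hA : IsResolventAt T l A)
    (hAn : ∀ᶠ n in atTop, IsResolventAt (Tn n) l (An n)) (hz : IsEigenvalue T z) :
    ∃ m : ℕ, algMult T z = m ∧
      ∃ U ∈ 𝓝 z, ∃ μ : ℕ → Fin m → ℂ,
        (∀ j, Tendsto (fun n => μ n j) atTop (𝓝 z)) ∧
        (∀ᶠ n in atTop, (∀ j, μ n j ∈ U) ∧
          ∀ w ∈ U, algMult (Tn n) w = (Nat.card {j : Fin m // μ n j = w} : ℕ∞)) ∧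
        UnitVectorsConverge (algEigenspace T z) (fun n => sumAlgEigenspaces (Tn n) (μ n)) := by
  have hzl : z ≠ l := by
    rintro rfl
    exact not_isEigenvalue_of_mem_resolventSet ⟨A, hA⟩ hz
  have h0 : z - l ≠ 0 := sub_ne_zero.2 hzl
  set μ₀ := (z - l)⁻¹ with hμ₀
  have hμ₀0 : μ₀ ≠ 0 := inv_ne_zero h0
  obtain ⟨r, hr, hball, hev, hfd, hfin, happ, hlim⟩ := h.exists_spectral_disc hEn hμ₀0
  have hL : algEigenspace T z = Module.End.maxGenEigenspace (A : Module.End ℂ E) μ₀ :=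
    hA.algEigenspace_eq hzl
  have hLfd : FiniteDimensional ℂ (algEigenspace T z) := by
    rw [hL]; exact finiteDimensional_maxGenEigenspace h.compact hμ₀0
  set m := Module.finrank ℂ (algEigenspace T z) with hm
  -- As `0⁻¹ = 0`, the disc avoiding `0` already keeps `l` out of the neighbourhood.
  have hUl : ∀ w, (w - l)⁻¹ ∈ Metric.closedBall μ₀ r → w ≠ l := by
    rintro w hw rfl
    exact hball _ hw (by simp)
  have : ∀ n, ∃ v : Fin m → ℂ, Module.finrank ℂ
        (genSup (An n : Module.End ℂ (En n)) (Metric.closedBall μ₀ r)) = m →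
      (∀ j, v j ∈ Metric.closedBall μ₀ r ∩
        {μ | Module.End.HasEigenvalue (An n : Module.End ℂ (En n)) μ}) ∧
      (∀ w ∈ Metric.closedBall μ₀ r,
        Module.finrank ℂ (Module.End.maxGenEigenspace (An n : Module.End ℂ (En n)) w) =
          Nat.card {j // v j = w}) ∧
      ⨆ j, Module.End.maxGenEigenspace (An n : Module.End ℂ (En n)) (v j) =
        genSup (An n : Module.End ℂ (En n)) (Metric.closedBall μ₀ r) := by
    intro n
    by_cases hn : Module.finrank ℂ
        (genSup (An n : Module.End ℂ (En n)) (Metric.closedBall μ₀ r)) = m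
    · have := hfd n
      obtain ⟨v, hv⟩ := exists_enumeration (An n : Module.End ℂ (En n)) _ hn
      exact ⟨v, fun _ => hv⟩
    · exact ⟨0, fun h => absurd h hn⟩
  choose v hv using this
  have hfin' : ∀ᶠ n in atTop, Module.finrank ℂ
      (genSup (An n : Module.End ℂ (En n)) (Metric.closedBall μ₀ r)) = m := by
    rw [hm, hL]; exact hfin
  have hv' := hfin'.mono fun n hn => hv n hn
  have hvt : ∀ j, Tendsto (fun n => v n j) atTop (𝓝 μ₀) := by
    intro j
    rw [Metric.tendsto_nhds]
    intro ε hε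
    filter_upwards [hv', hev ε hε] with n h1 h2
    exact h2 (h1.1 j)
  have hinv : ∀ n j, (l + (v n j)⁻¹ - l)⁻¹ = v n j := fun n j => by
    rw [add_sub_cancel_left, inv_inv]
  refine ⟨m, algMult_eq_finrank, {w | (w - l)⁻¹ ∈ Metric.closedBall μ₀ r}, ?_,
    fun n j => l + (v n j)⁻¹, ?_, ?_, ?_⟩
  · have hc : ContinuousAt (fun w : ℂ => (w - l)⁻¹) z :=
      (continuousAt_id.sub continuousAt_const).inv₀ h0
    exact hc.preimage_mem_nhds (Metric.closedBall_mem_nhds _ hr)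
  · intro j
    have := ((hvt j).inv₀ hμ₀0).const_add l
    rwa [hμ₀, inv_inv, add_sub_cancel] at this
  · filter_upwards [hv', hAn] with n h1 h2
    refine ⟨fun j => ?_, fun w hw => ?_⟩
    · rw [hinv]
      exact (h1.1 j).1
    · have hwl := hUl w hw
      have heq := h2.algEigenspace_eq hwl
      have hfdw : FiniteDimensional ℂ (algEigenspace (Tn n) w) := by
        rw [heq]
        exact finiteDimensional_maxGenEigenspace (h.compact_seq n) (hball _ hw)
      rw [algMult_eq_finrank, heq, h1.2.1 _ hw]
      congr 1
      refine Nat.card_congr (Equiv.subtypeEquivRight fun j => ?_)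
      constructor
      · intro hj
        rw [hj, inv_inv, add_sub_cancel]
      · intro hj
        rw [← hinv n j, hj]
  · rw [hL]
    refine unitVectorsConverge_of_ultrafilter (Vn := fun n =>
      genSup (An n : Module.End ℂ (En n)) (Metric.closedBall μ₀ r)) ?_ happ hlim
    filter_upwards [hv', hAn] with n h1 h2
    rw [sumAlgEigenspaces, ← h1.2.2]
    congr 1
    ext1 j
    have hj : (l + (v n j)⁻¹ - l)⁻¹ ∈ Metric.closedBall μ₀ r := by
      rw [hinv]; exact (h1.1 j).1
    rw [h2.algEigenspace_eq (hUl _ hj), hinv]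

theorem resolvent_eq_zero {F : Type*} [NormedAddCommGroup F] [NormedSpace ℂ F]
    {T : F →ₗ.[ℂ] F} {z : ℂ} (h : z ∉ resolventSet T) : resolvent T z = 0 :=
  dif_neg h

end Eigenvalues

end GSR

/-! ### The main theorem -/

theorem theorem2p6 {E₀ : Type*} [NormedAddCommGroup E₀] [NormedSpace ℂ E₀] [CompleteSpace E₀]
    (E : Submodule ℂ E₀) (En : ℕ → Submodule ℂ E₀)
    (hE : IsClosed (E : Set E₀)) (hEn : ∀ n, IsClosed (En n : Set E₀))
    (P : E₀ →L[ℂ] E) (Pn : ∀ n, E₀ →L[ℂ] En n)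
    (hP : GSR.IsProjectionOnto E P) (hPn : ∀ n, GSR.IsProjectionOnto (En n) (Pn n))
    (hPconv : ∀ x : E₀, Tendsto (fun n => (Pn n x : E₀)) atTop (𝓝 (P x : E₀)))
    (T : E →ₗ.[ℂ] E) (Tn : ∀ n, En n →ₗ.[ℂ] En n)
    (hT : T.IsClosed) (hTn : ∀ n, (Tn n).IsClosed)
    (hcomp : ∃ z₀ : ℂ, (∀ n, z₀ ∈ GSR.resolventSet (Tn n)) ∧ z₀ ∈ GSR.resolventSet T ∧
      IsCompactOperator (GSR.resolvent T z₀) ∧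
      (∀ n, IsCompactOperator (GSR.resolvent (Tn n) z₀)) ∧
      GSR.DiscretelyCompact E (fun n => GSR.resolvent (Tn n) z₀))
    (hgsr : GSR.GSRConv P Pn T Tn) :
    (GSR.regionOfBoundedness Tn = GSR.resolventSet T ∧
      ∀ z ∈ GSR.resolventSet T,
        GSR.StrongConv P Pn (GSR.resolvent T z) (fun n => GSR.resolvent (Tn n) z)) ∧
    GSR.SpectrallyExact T Tn ∧
    ∀ z : ℂ, GSR.IsEigenvalue T z → ∃ m : ℕ, GSR.algMult T z = m ∧
      ∃ U ∈ 𝓝 z, ∃ μ : ℕ → Fin m → ℂ,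
        (∀ j, Tendsto (fun n => μ n j) atTop (𝓝 z)) ∧
        (∀ᶠ n in atTop, (∀ j, μ n j ∈ U) ∧
          ∀ w ∈ U, GSR.algMult (Tn n) w = (Nat.card {j : Fin m // μ n j = w} : ℕ∞)) ∧
        GSR.UnitVectorsConverge (GSR.algEigenspace T z)
          (fun n => GSR.sumAlgEigenspaces (Tn n) (μ n)) := by
  have hcE : CompleteSpace E := hE.completeSpace_coe
  obtain ⟨z₀, hz₀n, hz₀, hc, hcn, hdc⟩ := hcomp
  obtain ⟨n₀, l, hln, hl, hs⟩ := hgsr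
  have hA := GSR.isResolventAt_resolvent hl
  have hA₀ := GSR.isResolventAt_resolvent hz₀
  have hAn : ∀ n ≥ n₀, GSR.IsResolventAt (Tn n) l (GSR.resolvent (Tn n) l) := fun n hn =>
    GSR.isResolventAt_resolvent (hln n hn)
  have hAn' : ∀ᶠ n in atTop, GSR.IsResolventAt (Tn n) l (GSR.resolvent (Tn n) l) :=
    eventually_atTop.2 ⟨n₀, hAn⟩
  obtain ⟨M, hM, hbd⟩ := hs.exists_bound hPn
  have hcomp_n : ∀ n, IsCompactOperator (GSR.resolvent (Tn n) l) := by
    intro n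
    by_cases hn : l ∈ GSR.resolventSet (Tn n)
    · exact (GSR.isResolventAt_resolvent (hz₀n n)).isCompactOperator
        (GSR.isResolventAt_resolvent hn) (hcn n)
    -- For the finitely many `n` with `l` outside the resolvent set, the default value `0` of
    -- `resolvent` is compact as well.
    · rw [GSR.resolvent_eq_zero hn]
      exact isCompactOperator_zero
  have hD : GSR.DiscreteConv E En (GSR.resolvent T l) (fun n => GSR.resolvent (Tn n) l) := by
    refine .of_strongConv hP hPn hPconv hs (hA₀.isCompactOperator hA hc) hcomp_n ?_
    intro U hU x R hx
    -- By the resolvent identity `(T_n - l)⁻¹ = (T_n - z₀)⁻¹ (1 + (l - z₀) (T_n - l)⁻¹)`, and the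
    -- right factor maps bounded sequences to bounded sequences.
    obtain ⟨y, hy⟩ := hdc.exists_lim hU (fun n => x n + (l - z₀) • GSR.resolvent (Tn n) l (x n))
      (R + ‖l - z₀‖ * (M * R)) (by
        filter_upwards [hx] with n hn
        refine (norm_add_le _ _).trans (add_le_add hn ?_)
        rw [norm_smul]
        gcongr
        exact (hbd n _).trans (by gcongr))
    refine ⟨y, hy.congr' ?_⟩
    filter_upwards [hU (eventually_ge_atTop n₀)] with n hn
    have h1 := (GSR.isResolventAt_resolvent (hz₀n n)).sub_eq (hAn n hn) (x n)
    rw [map_add, map_smul, ← h1, add_sub_cancel]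
  have henum := fun z (hz : GSR.IsEigenvalue T z) =>
    hD.exists_eigenvalue_enumeration hEn hA hAn' hz
  have hres := fun z (hz : z ∈ GSR.resolventSet T) =>
    hD.strongConv_resolvent hE hEn hP hPn hPconv hs hA hAn' hz
  refine ⟨⟨Set.Subset.antisymm ?_ fun z hz => (hres z hz).1, fun z hz => (hres z hz).2⟩,
    ⟨?_, fun z => hD.not_isSpurious hE hEn hbd hA hAn'⟩, henum⟩
  · exact fun z hz => hD.mem_resolventSet_of_mem_regionOfBoundedness hE hA hAn' hz
  · intro z hz
    have hev := hA.isEigenvalue_iff.2 ((hA.mem_spectrum_iff hD.compact).1 hz)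
    obtain ⟨m, hm, U, -, μ, hμ, hmult, -⟩ := henum z hev
    have hm0 : 0 < m := by
      refine Nat.pos_of_ne_zero fun h => GSR.isEigenvalue_ne_zero_algMult hev ?_
      rw [hm, h, Nat.cast_zero]
    refine ⟨fun n => μ n ⟨0, hm0⟩, ?_, hμ _⟩
    -- A listed point in the resolvent set would have multiplicity zero, although its own index is
    -- counted.
    filter_upwards [hmult] with n hn hres
    have h1 := hn.2 _ (hn.1 ⟨0, hm0⟩)
    rw [GSR.algMult_eq_zero_of_not_isEigenvalue
      (GSR.not_isEigenvalue_of_mem_resolventSet hres)] at h1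
    have : Nonempty {j // μ n j = μ n ⟨0, hm0⟩} := ⟨⟨_, rfl⟩⟩
    exact Nat.card_pos.ne' (by exact_mod_cast h1.symm)
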